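/- Let $m\ge 1$ be an integer. Let $w_s(x)=e^{\gamma_s x}r_s(x)$, $1\le s\le m$, where $\gamma_s\in\mathbb{R}$ and $r_s\in C^{m-s}(\mathbb{R})$ is strictly positive and $1$-periodic, and put $$u_s(x)=w_1(x)\int_0^x w_2(t_2)\int_0^{t_2}w_3(t_3)\cdots\int_0^{t_{s-1}}w_s(t_s)\,dt_s\cdots dt_2,\qquad 1\le s\le m .$$ Let $\varphi:\mathbb{R}\to\mathbb{C}$ be a periodic exponential B-spline of order $m$ for these weights with support $[0,m]$, that is: $\varphi\in C^{m-2}(\mathbb{R})$ (no condition if $m=1$); on every interval $(k,k+1)$, $k\in\mathbb{Z}$, $\varphi$ coincides with an element of $\operatorname{span}_{\mathbb{C}}(u_1,\dots,u_m)$; $\varphi$ is right-continuous; and $\operatorname{supp}\varphi=[0,m]$. For $1\le p\le\infty$ let $$V^p(\varphi)=\Big\{f\in L^p(\mathbb{R}) : f(x)=\sum_{\ell\in\mathbb{Z}}c_\ell\,\varphi(x-\ell),\ (c_\ell)_{\ell\in\mathbb Z}\in\ell^p(\mathbb{Z})\Big\},$$ with $f$ and its derivatives $f^{(s)}$, $0\le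 s\le m-1$, evaluated pointwise, where at the integers $f^{(m-1)}$ denotes the right-hand limit. **Theorem.** For every $\nu>0$ and every sequence $(\mu_j)_{j\in\mathbb{Z}}$ with values in $\{0,\dots,m-1\}$ there is a strictly increasing sequence $(x_j)_{j\in\mathbb{Z}}$ of real numbers, contained in a lattice $\alpha\mathbb{Z}$ for some $\alpha>0$, such that the set $X=\{x_j: j\in\mathbb{Z}\}$ with the multiplicity function $\mu_X(x_j)=\mu_j$ has the following properties. 1. For every $p\in[1,\infty]$, $(X,\mu_X)$ is a sampling set for $V^p(\varphi)$: there are constants $0<A,B<\infty$ such that for all $f\in V^p(\varphi)$ $$A\|f\|_p^p\le\sum_{x\in X}\sum_{s=0}^{\mu_X(x)}|f^{(s)}(x)|^p\le B\|f\|_p^p$$ if $p<\infty$, and $A\|f\|_\infty\le\sup_{x\in X}\max_{0\le s\le\mu_X(x)}|f^{(s)}(x)|\le B\|f\|_\infty$ if $p=\infty$. 2. The weighted lower Beurling density satisfies $$D^-(X,\mu_X)=\liminf_{R\to\infty}\,\inf_{y\in\mathbb{R}}\frac1{2R}\sum_{x\in X\cap[y-R,y+R]}(1+\mu_X(x))<1+\nu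 .$$ -/

import Mathlib

open scoped ENNReal NNReal

namespace ShiftInvariant

noncomputable section

/-- `nestedInt w i n x` is the `n`-fold nested integral
`∫₀ˣ w_i(t₁) ∫₀^{t₁} w_{i+1}(t₂) ⋯ ∫₀^{t_{n-1}} w_{i+n-1}(t_n) dt_n ⋯ dt₁`. -/
def nestedInt (w : ℕ → ℝ → ℝ) : ℕ → ℕ → ℝ → ℝ
  | _, 0 => fun _ => 1
  | i, n + 1 => fun x => ∫ t in (0 : ℝ)..x, w i t * nestedInt w (i + 1) n t

/-- The function `u_{j+1} = w₁ ∫ w₂ ∫ ⋯ ∫ w_{j+1}` of the extended complete Chebyshev system with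
weights `w₁, w₂, …`. The integrals start at `0`; another starting point gives a system
with the same span. -/
def eccFun (w : ℕ → ℝ → ℝ) (j : ℕ) (x : ℝ) : ℝ :=
  w 1 x * nestedInt w 2 j x

/-- `φ` is a periodic exponential B-spline of order `m` with support `[0, m]`: for some weights
`w_s(x) = e^{γ_s x} r_s(x)`, `1 ≤ s ≤ m`, with `r_s` positive, `1`-periodic and `C^{m-s}`, the
function `φ` is a Chebyshev spline with knots `ℤ`, that is, it is `C^{m-2}` (no condition
if `m = 1`), it lies on each interval between consecutive knots in the complex span of
`u₁, …, u_m`, its values at the knots are right-hand limits (this only matters if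
`m = 1`), and its support is exactly `[0, m]`. -/
def IsPEBSpline (m : ℕ) (φ : ℝ → ℂ) : Prop :=
  ∃ (γ : ℕ → ℝ) (r : ℕ → ℝ → ℝ),
    (∀ s ∈ Finset.Icc 1 m,
      ContDiff ℝ ((m - s : ℕ) : ℕ∞) (r s) ∧ Function.Periodic (r s) 1 ∧ ∀ x, 0 < r s x) ∧
    (∀ n : ℕ, n + 2 ≤ m → ContDiff ℝ (n : ℕ∞) φ) ∧
    (∀ k : ℤ, ∃ c : ℕ → ℂ, ∀ x ∈ Set.Ioo (k : ℝ) (k + 1),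
      φ x = ∑ j ∈ Finset.range m,
        c j * (eccFun (fun s y => Real.exp (γ s * y) * r s y) j x : ℂ)) ∧
    (∀ x : ℝ, ContinuousWithinAt φ (Set.Ici x) x) ∧
    tsupport φ = Set.Icc (0 : ℝ) m

/-- The shift-invariant space `V^p(φ)`; its elements are the functions
`f(x) = ∑_ℓ c_ℓ φ(x - ℓ)` in `L^p(ℝ)`, `c ∈ ℓ^p(ℤ)`, with the pointwise values of the series. -/
def shiftSpace (p : ℝ≥0∞) (φ : ℝ → ℂ) : Set (ℝ → ℂ) :=
  {f | MeasureTheory.MemLp f p MeasureTheory.volume ∧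
    ∃ c : ℤ → ℂ, Memℓp c p ∧ ∀ x : ℝ, HasSum (fun l : ℤ => c l * φ (x - l)) (f x)}

/-- The `s`-th right-hand derivative of `f` at `x`. Where `f` is `s` times continuously
differentiable this is the usual derivative `f^{(s)}(x)`; for a spline of order `m` and
`s = m - 1` its value at a knot is the limit of `f^{(s)}` from the right. -/
def rderiv (s : ℕ) (f : ℝ → ℂ) (x : ℝ) : ℂ :=
  iteratedDerivWithin s f (Set.Ici x) x

/-- `(X, μ)` is a sampling set for `V^p(φ)`:
`A ‖f‖_p^p ≤ ∑_{x ∈ X} ∑_{s ≤ μ(x)} |f^{(s)}(x)|^p ≤ B ‖f‖_p^p` for all `f ∈ V^p(φ)`, with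
constants `0 < A, B < ∞`; for `p = ∞` with suprema in place of sums. The sums and norms are
taken in `[0, ∞]`. -/
def IsSampling (p : ℝ≥0∞) (φ : ℝ → ℂ) (X : Set ℝ) (μ : X → ℕ) : Prop :=
  ∃ A B : ℝ≥0, 0 < A ∧ 0 < B ∧ ∀ f ∈ shiftSpace p φ,
    if p = ∞ then
      (A : ℝ≥0∞) * MeasureTheory.eLpNorm f ∞ MeasureTheory.volume ≤
          (⨆ x : X, ⨆ s ∈ Finset.range (μ x + 1), ‖rderiv s f x‖ₑ) ∧
        (⨆ x : X, ⨆ s ∈ Finset.range (μ x + 1), ‖rderiv s f x‖ₑ) ≤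
          (B : ℝ≥0∞) * MeasureTheory.eLpNorm f ∞ MeasureTheory.volume
    else
      (A : ℝ≥0∞) * MeasureTheory.eLpNorm f p MeasureTheory.volume ^ p.toReal ≤
          (∑' x : X, ∑ s ∈ Finset.range (μ x + 1), ‖rderiv s f x‖ₑ ^ p.toReal) ∧
        (∑' x : X, ∑ s ∈ Finset.range (μ x + 1), ‖rderiv s f x‖ₑ ^ p.toReal) ≤
          (B : ℝ≥0∞) * MeasureTheory.eLpNorm f p MeasureTheory.volume ^ p.toReal

/-- The weighted lower Beurling density
`D⁻(X, μ) = liminf_{R → ∞} inf_y (1 / 2R) ∑_{x ∈ X ∩ [y - R, y + R]} (1 + μ(x))` in `[0, ∞]`. -/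
def lowerDensity (X : Set ℝ) (μ : X → ℕ) : ℝ≥0∞ :=
  Filter.liminf
    (fun R : ℝ => ⨅ y : ℝ,
      (∑' x : {x : X // (x : ℝ) ∈ Set.Icc (y - R) (y + R)}, (1 + (μ x : ℝ≥0∞))) /
        ENNReal.ofReal (2 * R))
    Filter.atTop

end

end ShiftInvariant

/-! On a cell `[k, k + 1)` a function `∑ c_ℓ φ(x - ℓ)` involves only the `m` coefficients with `k -
m < ℓ ≤ k`, and the corresponding translates of `φ` are linearly independent on every subinterval of
the cell. Hence `m` suitable point values in one cell determine all active coefficients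
(`exists_nodes`). Moreover, for each `d ≤ m` a Wronskian is nonzero somewhere in the cell, so that
`d` derivatives at one node determine the `d` newest coefficients once the older ones are known
(`exists_hermite_node`).

The samples come in blocks of `M`. A block opens with `m` samples in one new cell, whose values
alone fix the coefficients there. Every later sample `x_j` moves `μ_j + 1` cells ahead and so meets
exactly as many new coefficients as it carries data. The data of a block exceed its cells by at most
`m²`, which gives density at most `1 + m²/(M - m)`. Restarting in each block stops the propagation
of errors: the constants depend on `M` but not on the block (`exists_block_bound`), and such uniform
local estimates add up to `ℓ^p` estimates for all `p` (`isSampling`). Only finitely many rational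
offsets within cells occur, so all nodes lie in one lattice.

Local independence rests on a Rolle argument: dividing a Chebyshev spline by its first weight and
differentiating lowers the order by one and creates one more sign alternation
(`alternation_le_of_spline`). Hence a nonzero spline of order `m` cannot live on fewer than `m`
cells. -/

namespace ShiftInvariant

/-! ### Chebyshev systems: smoothness, independence, translation -/

/-- The `j`-th function of the extended complete Chebyshev system with weights
`w i, w (i + 1), …`. -/
noncomputable def ecc (w : ℕ → ℝ → ℝ) (i j : ℕ) (x : ℝ) : ℝ :=
  w i x * nestedInt w (i + 1) j x

theorem ecc_zero (w : ℕ → ℝ → ℝ) (i : ℕ) (x : ℝ) : ecc w i 0 x = w i x := by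
  simp [ecc, nestedInt]

theorem continuous_nestedInt {w : ℕ → ℝ → ℝ} (n : ℕ) : ∀ i : ℕ,
    (∀ s, i ≤ s → s < i + n → Continuous (w s)) → Continuous (nestedInt w i n) := by
  induction n with
  | zero => intro i _; exact continuous_const
  | succ n ih =>
    intro i hw
    have hc : Continuous fun t => w i t * nestedInt w (i + 1) n t :=
      (hw i le_rfl (by omega)).mul (ih (i + 1) fun s h1 h2 => hw s (by omega) (by omega))
    exact intervalIntegral.continuous_primitive (fun a b => hc.intervalIntegrable a b) 0

theorem continuous_ecc {w : ℕ → ℝ → ℝ} {i j : ℕ}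
    (hw : ∀ s, i ≤ s → s < i + (j + 1) → Continuous (w s)) : Continuous (ecc w i j) :=
  (hw i le_rfl (by omega)).mul
    (continuous_nestedInt j (i + 1) fun s h1 h2 => hw s (by omega) (by omega))

theorem hasDerivAt_nestedInt {w : ℕ → ℝ → ℝ} {i n : ℕ}
    (hw : ∀ s, i ≤ s → s < i + (n + 1) → Continuous (w s)) (x : ℝ) :
    HasDerivAt (nestedInt w i (n + 1)) (ecc w i n x) x := by
  have hc : Continuous (ecc w i n) := continuous_ecc hw
  exact intervalIntegral.integral_hasDerivAt_right (hc.intervalIntegrable _ _)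
    (hc.stronglyMeasurableAtFilter _ _) hc.continuousAt

/-- Each integration gains one derivative, and the factor `w i` caps the integrand at `C^{m-i}`; the
two effects balance along the chain of weights. -/
theorem contDiff_nestedInt {w : ℕ → ℝ → ℝ} {m : ℕ} (n : ℕ) : ∀ i : ℕ,
    (∀ s, i ≤ s → s < i + n → ContDiff ℝ (m - s : ℕ) (w s)) → i + n ≤ m + 1 →
    ContDiff ℝ (m + 1 - i : ℕ) (nestedInt w i n) := by
  induction n with
  | zero => intro i _ _; exact contDiff_const
  | succ n ih =>
    intro i hw him
    have hd : deriv (nestedInt w i (n + 1)) = ecc w i n := funext fun x =>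
      (hasDerivAt_nestedInt (fun s h1 h2 => (hw s h1 h2).continuous) x).deriv
    have e : m + 1 - i = (m - i) + 1 := by omega
    rw [e]
    push_cast
    refine contDiff_succ_iff_deriv.2 ⟨fun x => (hasDerivAt_nestedInt
      (fun s h1 h2 => (hw s h1 h2).continuous) x).differentiableAt, by simp, ?_⟩
    rw [hd]
    refine ContDiff.mul (hw i le_rfl (by omega)) ?_
    have := ih (i + 1) (fun s h1 h2 => hw s (by omega) (by omega)) (by omega)
    rwa [show m + 1 - (i + 1) = m - i by omega] at this

theorem contDiff_ecc {w : ℕ → ℝ → ℝ} {m i j : ℕ}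
    (hw : ∀ s, i ≤ s → s < i + (j + 1) → ContDiff ℝ (m - s : ℕ) (w s)) (h : i + j ≤ m) :
    ContDiff ℝ (m - i : ℕ) (ecc w i j) := by
  refine ContDiff.mul (hw i le_rfl (by omega)) ?_
  have := contDiff_nestedInt (m := m) j (i + 1) (fun s h1 h2 => hw s (by omega) (by omega))
    (by omega)
  rwa [show m + 1 - (i + 1) = m - i by omega] at this

/-- An element of the span of a Chebyshev system that vanishes on an interval is zero. -/
theorem ecc_coeff_eq_zero {w : ℕ → ℝ → ℝ} {p q : ℝ} (hpq : p < q) (d : ℕ) :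
    ∀ (i : ℕ) (c : ℕ → ℂ), (∀ s, i ≤ s → s < i + d → Continuous (w s)) →
      (∀ s, i ≤ s → s < i + d → ∀ x, 0 < w s x) →
      (∀ x ∈ Set.Ioo p q, ∑ j ∈ Finset.range d, c j * (ecc w i j x : ℂ) = 0) →
      ∀ j < d, c j = 0 := by
  induction d with
  | zero => intro i c _ _ _ j hj; omega
  | succ d ih =>
    intro i c hw hpos h
    -- Division by `w i` turns the first function into a constant. Differentiation then removes it
    -- and leaves the shorter system that starts at `w (i + 1)`.
    have hN : ∀ x ∈ Set.Ioo p q,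
        c 0 + ∑ j ∈ Finset.range d, c (j + 1) * (nestedInt w (i + 1) (j + 1) x : ℂ) = 0 := by
      intro x hx
      have h1 := h x hx
      have h2 : (w i x : ℂ) ≠ 0 := by exact_mod_cast (hpos i le_rfl (by omega) x).ne'
      rw [Finset.sum_range_succ'] at h1
      simp only [ecc, Complex.ofReal_mul, nestedInt] at h1
      apply mul_left_cancel₀ h2
      rw [mul_zero, ← h1, mul_add, Finset.mul_sum, add_comm]
      congr 1
      · exact Finset.sum_congr rfl fun j _ => by simp only [nestedInt]; ring
      · simp; ring
    have hder : ∀ x ∈ Set.Ioo p q,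
        ∑ j ∈ Finset.range d, c (j + 1) * (ecc w (i + 1) j x : ℂ) = 0 := by
      intro x hx
      have h1 : HasDerivAt (fun x => c 0 +
          ∑ j ∈ Finset.range d, c (j + 1) * (nestedInt w (i + 1) (j + 1) x : ℂ))
          (∑ j ∈ Finset.range d, c (j + 1) * (ecc w (i + 1) j x : ℂ)) x := by
        refine HasDerivAt.const_add _ (HasDerivAt.fun_sum fun j hj => ?_)
        have hj := Finset.mem_range.1 hj
        exact (hasDerivAt_nestedInt (fun s h1 h2 => hw s (by omega) (by omega))
          x).ofReal_comp.const_mul _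
      have h2 : (fun x => c 0 +
          ∑ j ∈ Finset.range d, c (j + 1) * (nestedInt w (i + 1) (j + 1) x : ℂ))
          =ᶠ[nhds x] fun _ => 0 := by
        filter_upwards [isOpen_Ioo.mem_nhds hx] with y hy using hN y hy
      have h3 := h2.deriv_eq
      rw [h1.deriv] at h3
      simpa using h3
    have hc := ih (i + 1) (fun j => c (j + 1)) (fun s h1 h2 => hw s (by omega) (by omega))
      (fun s h1 h2 => hpos s (by omega) (by omega)) hder
    intro j hj
    rcases j with _ | j
    · have hx : (p + q) / 2 ∈ Set.Ioo p q := ⟨by linarith, by linarith⟩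
      have := hN _ hx
      rwa [Finset.sum_eq_zero, add_zero] at this
      intro j hj
      rw [hc j (Finset.mem_range.1 hj), zero_mul]
    · exact hc j (by omega)

/-- Splitting the outer integral at `1` gives a constant plus the integral of the translated
integrand; there the quasi-periodic weight contributes the factor `q i`, and the inner integral is
handled by induction. -/
theorem nestedInt_add_one {w : ℕ → ℝ → ℝ} {q : ℕ → ℝ} (n : ℕ) : ∀ i : ℕ,
    (∀ s, i ≤ s → s < i + n → Continuous (w s)) →
    (∀ s, i ≤ s → s < i + n → ∀ x, w s (x + 1) = q s * w s x) →
    ∃ c : ℕ → ℝ, ∀ x, nestedInt w i n (x + 1) =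
      ∑ j ∈ Finset.range (n + 1), c j * nestedInt w i j x := by
  induction n with
  | zero => intro i _ _; exact ⟨fun _ => 1, fun x => by simp [nestedInt]⟩
  | succ n ih =>
    intro i hw hq
    obtain ⟨c, hc⟩ := ih (i + 1) (fun s h1 h2 => hw s (by omega) (by omega))
      (fun s h1 h2 => hq s (by omega) (by omega))
    have hcont : Continuous (ecc w i n) := continuous_ecc hw
    refine ⟨fun j => Nat.casesOn j (nestedInt w i (n + 1) 1) fun j => q i * c j, fun x => ?_⟩
    rw [Finset.sum_range_succ']
    have h1 : nestedInt w i (n + 1) (x + 1) =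
        nestedInt w i (n + 1) 1 + ∫ t in (1 : ℝ)..(x + 1), ecc w i n t :=
      (intervalIntegral.integral_add_adjacent_intervals (hcont.intervalIntegrable _ _)
        (hcont.intervalIntegrable _ _)).symm
    have h2 : ∫ t in (1 : ℝ)..(x + 1), ecc w i n t = ∫ t in (0 : ℝ)..x, ecc w i n (t + 1) := by
      rw [intervalIntegral.integral_comp_add_right]; norm_num
    have h3 : ∀ t, ecc w i n (t + 1) =
        ∑ j ∈ Finset.range (n + 1), q i * c j * ecc w i j t := by
      intro t
      rw [ecc, hq i le_rfl (by omega), hc, Finset.mul_sum]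
      exact Finset.sum_congr rfl fun j _ => by simp only [ecc]; ring
    rw [h1, h2]
    simp_rw [h3]
    rw [intervalIntegral.integral_finsetSum]
    · simp_rw [intervalIntegral.integral_const_mul]
      simp only [nestedInt, mul_one, ecc]
      rw [add_comm]
      rfl
    · intro j hj
      have hj := Finset.mem_range.1 hj
      exact ((continuous_ecc fun s h1 h2 => hw s (by omega) (by omega)).const_mul
        _).intervalIntegrable _ _

/-- The span of a Chebyshev system with quasi-periodic weights is invariant under integer
translations. -/
theorem exists_sum_ecc_add_nat {w : ℕ → ℝ → ℝ} {q : ℕ → ℝ} {i d : ℕ}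
    (hw : ∀ s, i ≤ s → s < i + d → Continuous (w s))
    (hq : ∀ s, i ≤ s → s < i + d → ∀ x, w s (x + 1) = q s * w s x) (n : ℕ) (a : ℕ → ℂ) :
    ∃ b : ℕ → ℂ, ∀ x : ℝ, ∑ j ∈ Finset.range d, a j * (ecc w i j (x + n) : ℂ) =
      ∑ j ∈ Finset.range d, b j * (ecc w i j x : ℂ) := by
  induction n generalizing a with
  | zero => exact ⟨a, fun x => by simp⟩
  | succ n ih =>
    have h1 : ∀ j, ∃ c : ℕ → ℝ, j < d → ∀ x, ecc w i j (x + 1) =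
        ∑ l ∈ Finset.range d, c l * ecc w i l x := by
      intro j
      by_cases hj : j < d
      · obtain ⟨c, hc⟩ := nestedInt_add_one (w := w) (q := q) j (i + 1)
          (fun s h1 h2 => hw s (by omega) (by omega)) (fun s h1 h2 => hq s (by omega) (by omega))
        refine ⟨fun l => if l < j + 1 then q i * c l else 0, fun _ x => ?_⟩
        rw [← Finset.sum_subset (Finset.range_subset_range.2 (show j + 1 ≤ d by omega)), ecc,
          hq i le_rfl (by omega), hc, Finset.mul_sum]
        · refine Finset.sum_congr rfl fun l hl => ?_
          simp only [if_pos (Finset.mem_range.1 hl), ecc]; ring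
        · intro l _ hl
          simp only [if_neg (mt Finset.mem_range.2 hl), zero_mul]
      · exact ⟨0, fun h => absurd h hj⟩
    choose c hc using h1
    obtain ⟨b, hb⟩ := ih (fun l => ∑ j ∈ Finset.range d, a j * c j l)
    refine ⟨b, fun x => ?_⟩
    rw [← hb]
    simp_rw [Finset.sum_mul]
    rw [Finset.sum_comm]
    refine Finset.sum_congr rfl fun j hj => ?_
    rw [show x + ((n + 1 : ℕ) : ℝ) = x + n + 1 by push_cast; ring,
      hc j (Finset.mem_range.1 hj)]
    push_cast
    rw [Finset.mul_sum]
    exact Finset.sum_congr rfl fun l _ => by ring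

end ShiftInvariant

/-! ### Sign alternations of Chebyshev splines -/

namespace ShiftInvariant

/-- A function with right derivatives that increases between two points has a positive right
derivative somewhere between them. -/
theorem exists_pos_of_hasDerivWithinAt_Ici {f f' : ℝ → ℝ} {a b : ℝ} (hab : a < b)
    (hf : ContinuousOn f (Set.Icc a b))
    (hf' : ∀ x ∈ Set.Ico a b, HasDerivWithinAt f (f' x) (Set.Ici x) x) (h : f a < f b) :
    ∃ x ∈ Set.Ico a b, 0 < f' x := by
  by_contra! hneg
  have := image_le_of_deriv_right_le_deriv_boundary hf hf' (B := fun _ => f a) (B' := fun _ => 0)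
    le_rfl continuousOn_const (fun x _ => hasDerivWithinAt_const _ _ _) hneg
    (Set.right_mem_Icc.2 hab.le)
  exact absurd this (not_le.2 h)

theorem exists_pos_mul_of_hasDerivWithinAt_Ici {f f' : ℝ → ℝ} {a b σ : ℝ} (hab : a < b)
    (hf : Continuous f) (hf' : ∀ x, HasDerivWithinAt f (f' x) (Set.Ici x) x)
    (h : 0 < σ * (f b - f a)) : ∃ x ∈ Set.Ico a b, 0 < σ * f' x :=
  exists_pos_of_hasDerivWithinAt_Ici hab (f := fun x => σ * f x) (f' := fun x => σ * f' x)
    (hf.const_mul σ).continuousOn (fun x _ => (hf' x).const_mul σ)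
    (by linarith)

/-- **Rolle's theorem for sign alternations**: if `f` vanishes at `a` and `b` and alternates in sign
at `Z` points between them, then its right derivative alternates in sign at `Z + 1` points. -/
theorem exists_alternation_of_hasDerivWithinAt_Ici {f f' : ℝ → ℝ} {a b σ : ℝ} {Z : ℕ} {t : ℕ → ℝ}
    (hf : Continuous f) (hf' : ∀ x, HasDerivWithinAt f (f' x) (Set.Ici x) x)
    (ha : f a = 0) (hb : f b = 0) (hZ : 1 ≤ Z) (ht : ∀ j, j + 1 < Z → t j < t (j + 1))
    (hat : ∀ j < Z, a < t j) (htb : ∀ j < Z, t j < b)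
    (hsign : ∀ j < Z, 0 < σ * (-1) ^ j * f (t j)) :
    ∃ t' : ℕ → ℝ, (∀ j, j + 1 < Z + 1 → t' j < t' (j + 1)) ∧ (∀ j < Z + 1, t' j < b) ∧
      ∀ j < Z + 1, 0 < σ * (-1) ^ j * f' (t' j) := by
  -- The `Z + 2` points `a, t 0, …, t (Z - 1), b`. From each one to the next, `f` moves in the
  -- direction of the sign `σ (-1)^j`, which yields `Z + 1` points for the derivative.
  let T : ℕ → ℝ := fun j => Nat.casesOn j a fun j => if j < Z then t j else b
  have T0 : T 0 = a := rfl
  have T1 : ∀ j < Z, T (j + 1) = t j := fun j hj => if_pos hj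
  have T2 : T (Z + 1) = b := if_neg (lt_irrefl Z)
  have hTb : ∀ j ≤ Z + 1, T j ≤ b := by
    intro j hj
    rcases j with _ | j
    · exact ((hat 0 hZ).trans (htb 0 hZ)).le
    · rcases Nat.lt_or_ge j Z with h | h
      · rw [T1 j h]; exact (htb j h).le
      · rw [show j = Z by omega, T2]
  have key : ∀ j, ∃ x, j < Z + 1 → x ∈ Set.Ico (T j) (T (j + 1)) ∧ 0 < σ * (-1) ^ j * f' x := by
    intro j
    by_cases hj : j < Z + 1
    swap
    · exact ⟨0, fun h => absurd h hj⟩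
    have hlt : T j < T (j + 1) := by
      rcases j with _ | j
      · rw [T0, T1 0 hZ]; exact hat 0 hZ
      · rw [T1 j (by omega)]
        rcases Nat.lt_or_ge (j + 1) Z with h | h
        · rw [T1 _ h]; exact ht j h
        · rw [show j + 1 = Z by omega, T2]; exact htb j (by omega)
    have hpos : 0 < σ * (-1) ^ j * (f (T (j + 1)) - f (T j)) := by
      have h1 : 0 ≤ σ * (-1) ^ j * f (T (j + 1)) := by
        rcases Nat.lt_or_ge j Z with h | h
        · rw [T1 _ h]; exact (hsign j h).le
        · rw [show j = Z by omega, T2, hb, mul_zero]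
      rcases j with _ | j
      · rw [T0, ha, sub_zero, T1 0 hZ]; exact hsign 0 hZ
      · have h2 := hsign j (by omega)
        rw [← T1 j (by omega)] at h2
        rw [pow_succ] at h1 ⊢
        linarith
    obtain ⟨x, hx, hx'⟩ := exists_pos_mul_of_hasDerivWithinAt_Ici hlt hf hf' hpos
    exact ⟨x, fun _ => ⟨hx, hx'⟩⟩
  choose t' ht' using key
  exact ⟨t', fun j hj => (ht' j (by omega)).1.2.trans_le (ht' (j + 1) hj).1.1,
    fun j hj => (ht' j hj).1.2.trans_le (hTb (j + 1) (by omega)),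
    fun j hj => (ht' j hj).2⟩

/-- A Chebyshev spline of order `d` with integer knots that vanishes to the left of `a` and on
`[b, b + 1)` has at most `b - a - d` sign changes to the left of `b`. -/
theorem alternation_le_of_spline {w : ℕ → ℝ → ℝ} {a b : ℤ} {σ : ℝ} (d : ℕ) (hd : 1 ≤ d) :
    ∀ (i : ℕ) (h : ℝ → ℝ) (Z : ℕ) (t : ℕ → ℝ),
    (∀ s, i ≤ s → s < i + d → ContDiff ℝ (i + d - 1 - s : ℕ) (w s)) →
    (∀ s, i ≤ s → s < i + d → ∀ x, 0 < w s x) →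
    (∀ n : ℕ, n + 2 ≤ d → ContDiff ℝ n h) →
    (∀ k : ℤ, ∃ c : ℕ → ℝ, ∀ x ∈ Set.Ico (k : ℝ) (k + 1),
      h x = ∑ j ∈ Finset.range d, c j * ecc w i j x) →
    (∀ x < (a : ℝ), h x = 0) → (∀ x ∈ Set.Ico (b : ℝ) (b + 1), h x = 0) →
    1 ≤ Z → (∀ j, j + 1 < Z → t j < t (j + 1)) → (∀ j < Z, t j < b) →
    (∀ j < Z, 0 < σ * (-1) ^ j * h (t j)) → (Z + d : ℤ) ≤ b - a + 1 := by
  induction d, hd using Nat.le_induction with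
  | base =>
    intro i h Z t _ hpos _ hpw ha _ hZ ht htb hsign
    -- For order one, `h` is a constant times a positive weight on each cell, so successive
    -- alternation points lie in different cells.
    have hfl : ∀ j < Z, a + j ≤ ⌊t j⌋ := by
      intro j
      induction j with
      | zero =>
        intro hj
        rw [Int.le_floor]
        by_contra! hlt
        have := hsign 0 hj
        rw [ha (t 0) (by simpa using hlt), mul_zero] at this
        exact this.false
      | succ j ih =>
        intro hj
        have h1 := ih (by omega)
        have h2 : ⌊t j⌋ ≤ ⌊t (j + 1)⌋ := Int.floor_le_floor (ht j hj).le
        rcases h2.lt_or_eq with h3 | h3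
        · push_cast; omega
        · exfalso
          obtain ⟨c, hc⟩ := hpw ⌊t j⌋
          have e1 := hc (t j) ⟨Int.floor_le _, Int.lt_floor_add_one _⟩
          have e2 := hc (t (j + 1)) ⟨by rw [h3]; exact Int.floor_le _,
            by rw [h3]; exact Int.lt_floor_add_one _⟩
          rw [Finset.sum_range_one, ecc_zero] at e1 e2
          have p1 := hsign j (by omega)
          have p2 := hsign (j + 1) hj
          rw [e1, ← mul_assoc] at p1
          rw [e2, ← mul_assoc] at p2
          have q1 := (pos_iff_pos_of_mul_pos p1).2 (hpos i le_rfl (by omega) _)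
          have q2 := (pos_iff_pos_of_mul_pos p2).2 (hpos i le_rfl (by omega) _)
          rw [pow_succ] at q2
          linarith
    have h1 := hfl (Z - 1) (by omega)
    have h2 : ⌊t (Z - 1)⌋ < b := Int.floor_lt.2 (htb _ (by omega))
    push_cast [Nat.cast_sub hZ] at *
    omega
  | succ d hd ih =>
    intro i h Z t hw hpos hsm hpw ha hb hZ ht htb hsign
    have hwc : ∀ s, i ≤ s → s < i + (d + 1) → Continuous (w s) := fun s h1 h2 =>
      (hw s h1 h2).continuous
    have hwi : ∀ x, 0 < w i x := hpos i le_rfl (by omega)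
    -- The right derivative of `H` is a spline of order `d` for the weights from `i + 1` on, and
    -- Rolle gives it `Z + 1` alternations: the sum of order and alternations is preserved.
    set H : ℝ → ℝ := fun x => h x / w i x with hH
    have hHsm : ∀ n : ℕ, n + 1 ≤ d → ContDiff ℝ n H := by
      intro n hn
      refine (hsm n (by omega)).div ?_ fun x => (hwi x).ne'
      exact (hw i le_rfl (by omega)).of_le (by exact_mod_cast (by omega))
    have hHc : Continuous H := (hHsm 0 (by omega)).continuous
    have hder : ∀ k : ℤ, ∃ c : ℕ → ℝ, ∀ x ∈ Set.Ico (k : ℝ) (k + 1), HasDerivWithinAt H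
        (∑ j ∈ Finset.range d, c j * ecc w (i + 1) j x) (Set.Ici x) x := by
      intro k
      obtain ⟨c, hc⟩ := hpw k
      refine ⟨fun j => c (j + 1), fun x hx => ?_⟩
      have hP : ∀ y ∈ Set.Ico (k : ℝ) (k + 1),
          H y = c 0 + ∑ j ∈ Finset.range d, c (j + 1) * nestedInt w (i + 1) (j + 1) y := by
        intro y hy
        rw [hH]
        simp only
        rw [hc y hy, div_eq_iff (hwi y).ne', Finset.sum_range_succ', ecc_zero, add_mul, add_comm,
          Finset.sum_mul]
        congr 1
        exact Finset.sum_congr rfl fun j _ => by rw [ecc]; ring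
      have h1 : HasDerivAt (fun x => c 0 +
          ∑ j ∈ Finset.range d, c (j + 1) * nestedInt w (i + 1) (j + 1) x)
          (∑ j ∈ Finset.range d, c (j + 1) * ecc w (i + 1) j x) x := by
        refine HasDerivAt.const_add _ (HasDerivAt.fun_sum fun j hj => ?_)
        have hj := Finset.mem_range.1 hj
        exact (hasDerivAt_nestedInt (fun s h1 h2 => hwc s (by omega) (by omega)) x).const_mul _
      refine h1.hasDerivWithinAt.congr_of_eventuallyEq ?_ (hP x hx)
      filter_upwards [Ico_mem_nhdsGE hx.2] with y hy
      exact hP y ⟨hx.1.trans hy.1, hy.2⟩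
    set H' : ℝ → ℝ := fun x => derivWithin H (Set.Ici x) x with hH'
    have hH'd : ∀ x, HasDerivWithinAt H (H' x) (Set.Ici x) x := by
      intro x
      obtain ⟨c, hc⟩ := hder ⌊x⌋
      exact (hc x ⟨Int.floor_le _, Int.lt_floor_add_one _⟩).differentiableWithinAt.hasDerivWithinAt
    have hH'pw : ∀ k : ℤ, ∃ c : ℕ → ℝ, ∀ x ∈ Set.Ico (k : ℝ) (k + 1),
        H' x = ∑ j ∈ Finset.range d, c j * ecc w (i + 1) j x := by
      intro k
      obtain ⟨c, hc⟩ := hder k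
      exact ⟨c, fun x hx => (hc x hx).derivWithin (uniqueDiffOn_Ici x x Set.self_mem_Ici)⟩
    have hH'sm : ∀ n : ℕ, n + 2 ≤ d → ContDiff ℝ n H' := by
      intro n hn
      have h1 : ContDiff ℝ (n + 1) H := by exact_mod_cast hHsm (n + 1) (by omega)
      obtain ⟨h2, _, h3⟩ := contDiff_succ_iff_deriv.1 h1
      have h4 : H' = deriv H := funext fun x =>
        (h2 x).derivWithin (uniqueDiffOn_Ici x x Set.self_mem_Ici)
      rwa [h4]
    -- Vanishing on the whole interval `[b, b + 1)`, and not just at `b`, is what passes on to the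
    -- right derivative.
    have hzero : ∀ x u : ℝ, x < u → (∀ y ∈ Set.Ico x u, h y = 0) → H' x = 0 := by
      intro x u hxu hy
      have h1 : HasDerivWithinAt H 0 (Set.Ici x) x := by
        refine (hasDerivWithinAt_const x (Set.Ici x) (0 : ℝ)).congr_of_eventuallyEq ?_ ?_
        · filter_upwards [Ico_mem_nhdsGE hxu] with y hy'
          simp [hH, hy y hy']
        · simp [hH, hy x ⟨le_rfl, hxu⟩]
      exact h1.derivWithin (uniqueDiffOn_Ici x x Set.self_mem_Ici)
    -- The left zero for Rolle is taken at `a - 1`, strictly to the left of all alternation points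
    -- even if `t 0 = a`.
    have hat : ∀ j < Z, (a : ℝ) - 1 < t j := by
      intro j hj
      by_contra! hlt
      have := hsign j hj
      rw [ha (t j) (by linarith), mul_zero] at this
      exact this.false
    obtain ⟨t', ht1, ht2, ht3⟩ := exists_alternation_of_hasDerivWithinAt_Ici (σ := σ) hHc hH'd
      (a := a - 1) (b := b) (by simp [hH, ha _ (sub_one_lt (a : ℝ))])
      (by simp [hH, hb b ⟨le_rfl, by linarith⟩]) hZ ht hat htb
      (fun j hj => by rw [hH, ← mul_div_assoc]; exact div_pos (hsign j hj) (hwi _))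
    have := ih (i + 1) H' (Z + 1) t'
      (fun s h1 h2 => by
        have := hw s (by omega) (by omega)
        rwa [show i + 1 + d - 1 - s = i + (d + 1) - 1 - s by omega])
      (fun s h1 h2 => hpos s (by omega) (by omega)) hH'sm hH'pw
      (fun x hx => hzero x a hx fun y hy => ha y hy.2)
      (fun x hx => hzero x (b + 1) hx.2 fun y hy => hb y ⟨hx.1.trans hy.1, hy.2⟩)
      (by omega) ht1 ht2 ht3
    push_cast at *
    omega

/-- A Chebyshev spline of order `d` that vanishes to the left of `a` and on `[b, b + 1)`, where
`b - a < d`, vanishes to the left of `b`. -/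
theorem spline_eq_zero_of_short_support {w : ℕ → ℝ → ℝ} {a b : ℤ} {d i : ℕ} (hd : 1 ≤ d)
    (hab : b - a < d) {h : ℝ → ℂ}
    (hw : ∀ s, i ≤ s → s < i + d → ContDiff ℝ (i + d - 1 - s : ℕ) (w s))
    (hpos : ∀ s, i ≤ s → s < i + d → ∀ x, 0 < w s x)
    (hsm : ∀ n : ℕ, n + 2 ≤ d → ContDiff ℝ n h)
    (hpw : ∀ k : ℤ, ∃ c : ℕ → ℂ, ∀ x ∈ Set.Ico (k : ℝ) (k + 1),
      h x = ∑ j ∈ Finset.range d, c j * (ecc w i j x : ℂ))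
    (ha : ∀ x < (a : ℝ), h x = 0) (hb : ∀ x ∈ Set.Ico (b : ℝ) (b + 1), h x = 0)
    {x : ℝ} (hx : x < b) : h x = 0 := by
  have key : ∀ L : ℂ →L[ℝ] ℝ, L (h x) = 0 := by
    intro L
    by_contra hne
    -- A single nonzero value is an alternation of length one, which already forces `d ≤ b - a`.
    -- Choosing `σ` as the value itself makes the sign condition a square.
    have := alternation_le_of_spline (w := w) (a := a) (b := b) (σ := L (h x)) d hd i
      (fun y => L (h y)) 1 (fun _ => x) hw hpos (fun n hn => L.contDiff.comp (hsm n hn))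
      (fun k => by
        obtain ⟨c, hc⟩ := hpw k
        refine ⟨fun j => L (c j), fun y hy => ?_⟩
        simp only [hc y hy, map_sum]
        refine Finset.sum_congr rfl fun j _ => ?_
        rw [mul_comm, ← Complex.real_smul, map_smul, smul_eq_mul, mul_comm])
      (fun y hy => by simp [ha y hy]) (fun y hy => by simp [hb y hy]) le_rfl
      (fun j hj => by omega) (fun _ _ => hx)
      (fun j hj => by
        have hj : j = 0 := by omega
        subst hj
        simpa using mul_self_pos.2 hne)
    omega
  exact Complex.ext (key Complex.reCLM) (key Complex.imCLM)

end ShiftInvariant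

/-! ### Local linear independence of the translates of the B-spline -/

namespace ShiftInvariant

/-- The properties of the generator `φ` that the sampling theorem uses: it vanishes off `[0, m)`,
and on `(0, 1)` its translates `φ (· + i)`, `i < m`, are smooth and locally linearly
independent. -/
structure IsLocalGenerator (m : ℕ) (φ : ℝ → ℂ) : Prop where
  eq_zero_of_neg : ∀ x < 0, φ x = 0
  eq_zero_of_ge : ∀ x, (m : ℝ) ≤ x → φ x = 0
  contDiffOn : ∀ i : ℕ, ContDiffOn ℝ (m - 1 : ℕ) (fun x => φ (x + i)) (Set.Ioo 0 1)
  exists_continuous : ∀ i : ℕ, ∃ e : ℝ → ℂ, Continuous e ∧ ∀ x ∈ Set.Ico (0 : ℝ) 1, φ (x + i) = e x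
  indep : ∀ p q : ℝ, p < q → 0 ≤ p → q ≤ 1 → ∀ a : ℕ → ℂ,
    (∀ x ∈ Set.Ioo p q, ∑ i ∈ Finset.range m, a i * φ (x + i) = 0) → ∀ i < m, a i = 0

theorem eq_of_eqOn_Ioo_of_continuousWithinAt {f g : ℝ → ℂ} {a b : ℝ} (hab : a < b)
    (hf : ContinuousWithinAt f (Set.Ici a) a) (hg : ContinuousWithinAt g (Set.Ici a) a)
    (h : ∀ x ∈ Set.Ioo a b, f x = g x) : f a = g a := by
  have h1 := hf.mono_left (nhdsWithin_mono a Set.Ioi_subset_Ici_self)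
  have h2 := hg.mono_left (nhdsWithin_mono a Set.Ioi_subset_Ici_self)
  refine tendsto_nhds_unique (h1.congr' ?_) h2
  filter_upwards [Ioo_mem_nhdsGT hab] with x hx using h x hx

/-- The translates stay in the same span because the weights are quasi-periodic. For independence, a
combination that vanishes on a subinterval vanishes on `[0, 1)`, hence to the left of `0` since only
`m - 1` cells remain there. Its leftmost translate with nonzero coefficient is then isolated on one
cell, against `supp φ = [0, m]`. -/
theorem IsPEBSpline.isLocalGenerator {m : ℕ} (hm : 1 ≤ m) {φ : ℝ → ℂ} (hφ : IsPEBSpline m φ) :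
    IsLocalGenerator m φ := by
  obtain ⟨γ, r, hr, hsm, hpw, hrc, hsupp⟩ := hφ
  set w : ℕ → ℝ → ℝ := fun s y => Real.exp (γ s * y) * r s y with hwdef
  have hw : ∀ s, 1 ≤ s → s < 1 + m → ContDiff ℝ (1 + m - 1 - s : ℕ) (w s) := by
    intro s h1 h2
    rw [show 1 + m - 1 - s = m - s by omega]
    have h3 := (hr s (Finset.mem_Icc.2 ⟨h1, by omega⟩)).1
    exact (Real.contDiff_exp.comp (contDiff_const.mul contDiff_id)).mul (by exact_mod_cast h3)
  have hwm : ∀ s, 1 ≤ s → s < 1 + m → ContDiff ℝ (m - s : ℕ) (w s) := by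
    intro s h1 h2
    have := hw s h1 h2
    rwa [show 1 + m - 1 - s = m - s by omega] at this
  have hwc : ∀ s, 1 ≤ s → s < 1 + m → Continuous (w s) := fun s h1 h2 => (hw s h1 h2).continuous
  have hpos : ∀ s, 1 ≤ s → s < 1 + m → ∀ x, 0 < w s x := fun s h1 h2 x =>
    mul_pos (Real.exp_pos _) ((hr s (Finset.mem_Icc.2 ⟨h1, by omega⟩)).2.2 x)
  have hq : ∀ s, 1 ≤ s → s < 1 + m → ∀ x, w s (x + 1) = Real.exp (γ s) * w s x := by
    intro s h1 h2 x
    simp only [hwdef]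
    rw [(hr s (Finset.mem_Icc.2 ⟨h1, by omega⟩)).2.1 x, mul_add, Real.exp_add]
    ring_nf
  have hecc : ∀ c : ℕ → ℂ, Continuous fun x => ∑ j ∈ Finset.range m, c j * (ecc w 1 j x : ℂ) := by
    intro c
    refine continuous_finsetSum _ fun j hj => continuous_const.mul
      (Complex.continuous_ofReal.comp (continuous_ecc fun s h1 h2 => hwc s h1 ?_))
    have := Finset.mem_range.1 hj
    omega
  have hpw' : ∀ k : ℤ, ∃ c : ℕ → ℂ, ∀ x ∈ Set.Ico (k : ℝ) (k + 1),
      φ x = ∑ j ∈ Finset.range m, c j * (ecc w 1 j x : ℂ) := by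
    intro k
    obtain ⟨c, hc⟩ := hpw k
    refine ⟨c, fun x hx => ?_⟩
    rcases hx.1.eq_or_lt with h | h
    · subst h
      exact eq_of_eqOn_Ioo_of_continuousWithinAt (lt_add_one _) (hrc _)
        (hecc c).continuousWithinAt hc
    · exact hc x ⟨h, hx.2⟩
  have hpwi : ∀ (i : ℕ) (k : ℤ), ∃ c : ℕ → ℂ, ∀ x ∈ Set.Ico (k : ℝ) (k + 1),
      φ (x + i) = ∑ j ∈ Finset.range m, c j * (ecc w 1 j x : ℂ) := by
    intro i k
    obtain ⟨c, hc⟩ := hpw' (k + i)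
    obtain ⟨b, hb⟩ := exists_sum_ecc_add_nat hwc hq i c
    refine ⟨b, fun x hx => ?_⟩
    rw [← hb, hc]
    push_cast
    exact ⟨by linarith [hx.1], by linarith [hx.2]⟩
  have hneg : ∀ x < 0, φ x = 0 := fun x hx =>
    image_eq_zero_of_notMem_tsupport (by rw [hsupp]; exact fun h => absurd h.1 (not_le.2 hx))
  have hgt : ∀ x, (m : ℝ) < x → φ x = 0 := fun x hx =>
    image_eq_zero_of_notMem_tsupport (by rw [hsupp]; exact fun h => absurd h.2 (not_le.2 hx))
  have hge : ∀ x, (m : ℝ) ≤ x → φ x = 0 := by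
    intro x hx
    rcases hx.eq_or_lt with h | h
    · subst h
      exact eq_of_eqOn_Ioo_of_continuousWithinAt (lt_add_one _) (hrc _)
        (g := fun _ => 0) continuousWithinAt_const fun y hy => hgt y hy.1
    · exact hgt x h
  have hne : ¬ ∀ x ∈ Set.Ioo (0 : ℝ) 1, φ x = 0 := by
    intro h
    have h0 : φ 0 = 0 := eq_of_eqOn_Ioo_of_continuousWithinAt zero_lt_one (hrc 0)
      (g := fun _ => 0) continuousWithinAt_const h
    have h1 : (0 : ℝ) ∈ tsupport φ := by rw [hsupp]; exact ⟨le_rfl, by positivity⟩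
    refine notMem_tsupport_iff_eventuallyEq.2 ?_ h1
    filter_upwards [Iio_mem_nhds (zero_lt_one (α := ℝ))] with x hx
    rcases lt_trichotomy x 0 with h | h | h
    · exact hneg x h
    · rw [h]; exact h0
    · exact ‹∀ x ∈ Set.Ioo (0 : ℝ) 1, φ x = 0› x ⟨h, hx⟩
  refine ⟨hneg, hge, fun i => ?_, fun i => ?_, ?_⟩
  · obtain ⟨c, hc⟩ := hpwi i 0
    have h1 : ContDiff ℝ (m - 1 : ℕ) fun x => ∑ j ∈ Finset.range m, c j * (ecc w 1 j x : ℂ) := by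
      refine ContDiff.sum fun j hj => contDiff_const.mul (Complex.ofRealCLM.contDiff.comp ?_)
      have hj := Finset.mem_range.1 hj
      exact contDiff_ecc (fun s h1 h2 => hwm s h1 (by omega)) (by omega)
    refine h1.contDiffOn.congr fun x hx => hc x ⟨by simpa using hx.1.le, by simpa using hx.2⟩
  · obtain ⟨c, hc⟩ := hpwi i 0
    exact ⟨_, hecc c, fun x hx => hc x ⟨by simpa using hx.1, by simpa using hx.2⟩⟩
  · intro p q hpq hp hq1 a ha
    choose c hc using hpwi
    have hG : ∀ k : ℤ, ∀ x ∈ Set.Ico (k : ℝ) (k + 1),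
        ∑ i ∈ Finset.range m, a i * φ (x + i) =
        ∑ j ∈ Finset.range m, (∑ i ∈ Finset.range m, a i * c i k j) * (ecc w 1 j x : ℂ) := by
      intro k x hx
      simp_rw [Finset.sum_mul]
      rw [Finset.sum_comm]
      refine Finset.sum_congr rfl fun i _ => ?_
      rw [hc i k x hx, Finset.mul_sum]
      exact Finset.sum_congr rfl fun j _ => by ring
    have hcoef := ecc_coeff_eq_zero hpq m 1 (fun j => ∑ i ∈ Finset.range m, a i * c i 0 j) hwc hpos
      fun x hx => by
        rw [← hG 0 x ⟨by push_cast; linarith [hx.1], by push_cast; linarith [hx.2]⟩]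
        exact ha x hx
    have hG0 : ∀ x ∈ Set.Ico (0 : ℝ) 1, ∑ i ∈ Finset.range m, a i * φ (x + i) = 0 := by
      intro x hx
      rw [hG 0 x (by simpa using hx)]
      exact Finset.sum_eq_zero fun j hj => by rw [hcoef j (Finset.mem_range.1 hj), zero_mul]
    have hGneg : ∀ x < 0, ∑ i ∈ Finset.range m, a i * φ (x + i) = 0 := by
      intro x hx
      -- The translates `φ (· + i)` with `i ≤ m - 1` vanish to the left of `1 - m`, so the possible
      -- support in `[1 - m, 0]` has length `m - 1 < m`.
      refine spline_eq_zero_of_short_support (w := w) (a := 1 - m) (b := 0) (d := m) (i := 1) hm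
        (by omega) (h := fun x => ∑ i ∈ Finset.range m, a i * φ (x + i)) hw hpos
        (fun n hn => ?_) (fun k => ⟨_, hG k⟩) (fun y hy => ?_) (by simpa using hG0)
        (by simpa using hx)
      · refine ContDiff.sum fun i _ => contDiff_const.mul
          (ContDiff.comp ?_ (contDiff_id.add contDiff_const))
        exact_mod_cast hsm n hn
      · refine Finset.sum_eq_zero fun i hi => ?_
        have hi : (i : ℝ) + 1 ≤ m := by exact_mod_cast Finset.mem_range.1 hi
        push_cast at hy
        rw [hneg _ (by linarith), mul_zero]
    by_contra! hex
    have hS : ((Finset.range m).filter fun i => a i ≠ 0).Nonempty := by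
      obtain ⟨i, hi, hai⟩ := hex
      exact ⟨i, by simp [hi, hai]⟩
    -- On `(-i, 1 - i)` with `i` the largest active index, translates with smaller index have not
    -- started yet, so only `a i * φ (· + i)` survives.
    obtain ⟨i, hi, himax⟩ := Finset.exists_max_image _ (fun i => i) hS
    rw [Finset.mem_filter, Finset.mem_range] at hi
    refine hne fun x hx => ?_
    have hsum : ∑ l ∈ Finset.range m, a l * φ (x - i + l) = 0 := by
      rcases Nat.eq_zero_or_pos i with h | h
      · subst h; exact hG0 _ ⟨by simpa using hx.1.le, by simpa using hx.2⟩
      · have : (1 : ℝ) ≤ i := by exact_mod_cast h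
        exact hGneg _ (by linarith [hx.2])
    rw [Finset.sum_eq_single i] at hsum
    · rw [sub_add_cancel] at hsum
      exact (mul_eq_zero.1 hsum).resolve_left hi.2
    · intro l hl hli
      rcases lt_or_gt_of_ne hli with h | h
      · have : (l : ℝ) + 1 ≤ i := by exact_mod_cast h
        rw [hneg _ (by linarith [hx.2]), mul_zero]
      · by_cases hal : a l = 0
        · rw [hal, zero_mul]
        · have := himax l (Finset.mem_filter.2 ⟨hl, hal⟩)
          omega
    · intro h
      exact absurd (Finset.mem_range.2 hi.1) h

end ShiftInvariant

/-! ### Nodes that determine coefficients -/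

namespace ShiftInvariant

/-- Functions that are linearly independent on every subinterval have a nonvanishing Wronskian on
some subinterval. -/
theorem exists_Ioo_wronskian_injective (n : ℕ) : ∀ (g : ℕ → ℝ → ℂ) (p q : ℝ), p < q →
    (∀ i < n, ContDiffOn ℝ (n - 1 : ℕ) (g i) (Set.Ioo p q)) →
    (∀ p' q', p ≤ p' → p' < q' → q' ≤ q → ∀ a : ℕ → ℂ,
      (∀ x ∈ Set.Ioo p' q', ∑ i ∈ Finset.range n, a i * g i x = 0) → ∀ i < n, a i = 0) →
    ∃ p' q', p ≤ p' ∧ p' < q' ∧ q' ≤ q ∧ ∀ x ∈ Set.Ioo p' q', ∀ a : ℕ → ℂ,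
      (∀ s < n, iteratedDeriv s (fun y => ∑ i ∈ Finset.range n, a i * g i y) x = 0) →
      ∀ i < n, a i = 0 := by
  induction n with
  | zero => exact fun g p q hpq _ _ => ⟨p, q, le_rfl, hpq, le_rfl, fun _ _ _ _ i hi => by omega⟩
  | succ n ih =>
    intro g p q hpq hg hind
    simp only [Nat.add_sub_cancel] at hg
    obtain ⟨x₀, hx₀, hgx₀⟩ : ∃ x ∈ Set.Ioo p q, g n x ≠ 0 := by
      by_contra! hall
      have := hind p q le_rfl hpq le_rfl (fun i => if i = n then 1 else 0)
        (fun x hx => by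
          simp only [ite_mul, one_mul, zero_mul]
          rw [Finset.sum_ite_eq' (Finset.range (n + 1)) n (fun i => g i x),
            if_pos (Finset.self_mem_range_succ n), hall x hx]) n (Nat.lt_succ_self n)
      simp at this
    have hev : ∀ᶠ x in nhds x₀, x ∈ Set.Ioo p q ∧ g n x ≠ 0 :=
      (isOpen_Ioo.eventually_mem hx₀).and
        (((hg n (Nat.lt_succ_self n)).continuousOn.continuousAt
          (isOpen_Ioo.mem_nhds hx₀)).eventually_ne hgx₀)
    obtain ⟨p₁, q₁, hx₁, hsub⟩ := mem_nhds_iff_exists_Ioo_subset.1 hev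
    have hpq₁ : p₁ < q₁ := hx₁.1.trans hx₁.2
    obtain ⟨hp₁, hq₁⟩ := (Set.Ioo_subset_Ioo_iff hpq₁).1 fun x hx => (hsub hx).1
    have hne : ∀ x ∈ Set.Ioo p₁ q₁, g n x ≠ 0 := fun x hx => (hsub hx).2
    have hgs : ∀ i < n + 1, ContDiffOn ℝ n (g i) (Set.Ioo p₁ q₁) := fun i hi =>
      (hg i hi).mono fun x hx => (hsub hx).1
    have hquot : ∀ i < n, ContDiffOn ℝ n (fun y => g i y / g n y) (Set.Ioo p₁ q₁) := by
      intro i hi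
      simp_rw [div_eq_mul_inv]
      exact (hgs i (by omega)).mul ((hgs n (by omega)).inv hne)
    have hdiff : ∀ i < n, ∀ x ∈ Set.Ioo p₁ q₁, DifferentiableAt ℝ (fun y => g i y / g n y) x := by
      intro i hi x hx
      have h1 := ((hquot i hi).contDiffAt (isOpen_Ioo.mem_nhds hx))
      exact h1.differentiableAt (by exact_mod_cast (by omega : n ≠ 0))
    have hFder : ∀ (a : ℕ → ℂ) (x), x ∈ Set.Ioo p₁ q₁ →
        HasDerivAt (fun y => ∑ i ∈ Finset.range n, a i * (g i y / g n y))
          (∑ i ∈ Finset.range n, a i * deriv (fun y => g i y / g n y) x) x := fun a x hx =>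
      HasDerivAt.fun_sum fun i hi =>
        ((hdiff i (Finset.mem_range.1 hi) x hx).hasDerivAt).const_mul _
    -- The induction runs on the derivatives of the quotients `g i / g n`. A relation among these
    -- integrates to a constant, which `g n` absorbs as one more term of a relation among the `g i`.
    obtain ⟨p', q', hp', hpq', hq', hgood⟩ := ih (fun i => deriv fun y => g i y / g n y) p₁ q₁ hpq₁
      (fun i hi => (hquot i hi).deriv_of_isOpen isOpen_Ioo
        (by exact_mod_cast (by omega : n - 1 + 1 ≤ n)))
      (by
        intro p' q' hp' hpq' hq' a ha i hi
        have hsub' : Set.Ioo p' q' ⊆ Set.Ioo p₁ q₁ := Set.Ioo_subset_Ioo hp' hq'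
        have hmid : (p' + q') / 2 ∈ Set.Ioo p' q' := ⟨by linarith, by linarith⟩
        have hconst : ∀ x ∈ Set.Ioo p' q', ∑ i ∈ Finset.range n, a i * (g i x / g n x) =
            ∑ i ∈ Finset.range n, a i * (g i ((p' + q') / 2) / g n ((p' + q') / 2)) := by
          intro x hx
          refine isOpen_Ioo.is_const_of_deriv_eq_zero (isPreconnected_Ioo)
            (f := fun x => ∑ i ∈ Finset.range n, a i * (g i x / g n x))
            (fun y hy => (hFder a y (hsub' hy)).differentiableAt.differentiableWithinAt)
            (fun y hy => ?_) hx hmid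
          rw [(hFder a y (hsub' hy)).deriv]
          exact ha y hy
        set κ := ∑ i ∈ Finset.range n, a i * (g i ((p' + q') / 2) / g n ((p' + q') / 2))
        have h1 := hind p' q' (hp₁.trans hp') hpq' (hq'.trans hq₁)
          (fun i => if i < n then a i else -κ)
          (fun x hx => by
            rw [Finset.sum_range_succ, if_neg (lt_irrefl n), ← hconst x hx, neg_mul,
              Finset.sum_mul, ← sub_eq_add_neg, sub_eq_zero]
            refine Finset.sum_congr rfl fun i hi => ?_
            rw [if_pos (Finset.mem_range.1 hi), mul_assoc, div_mul_cancel₀ _ (hne x (hsub' hx))])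
          i (by omega)
        simpa [hi] using h1)
    refine ⟨p', q', hp₁.trans hp', hpq', hq'.trans hq₁, fun x hx a ha => ?_⟩
    have hsub' : Set.Ioo p' q' ⊆ Set.Ioo p₁ q₁ := Set.Ioo_subset_Ioo hp' hq'
    have hx₁ := hsub' hx
    have hlt : ∀ i < n, a i = 0 := by
      refine hgood x hx a fun s hs => ?_
      have hev : (fun y => ∑ i ∈ Finset.range n, a i * deriv (fun y => g i y / g n y) y)
          =ᶠ[nhds x] deriv fun y => (∑ i ∈ Finset.range (n + 1), a i * g i y) * (g n y)⁻¹ := by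
        filter_upwards [isOpen_Ioo.mem_nhds hx₁] with y hy
        have h1 : (fun y => (∑ i ∈ Finset.range (n + 1), a i * g i y) * (g n y)⁻¹)
            =ᶠ[nhds y] fun y => ∑ i ∈ Finset.range n, a i * (g i y / g n y) + a n := by
          filter_upwards [isOpen_Ioo.mem_nhds hy] with z hz
          rw [Finset.sum_range_succ, add_mul, Finset.sum_mul, mul_assoc (a n),
            mul_inv_cancel₀ (hne z hz), mul_one]
          congr 1
          exact Finset.sum_congr rfl fun i _ => by rw [div_eq_mul_inv, mul_assoc]
        rw [h1.deriv_eq, ((hFder a y hy).add_const _).deriv]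
      -- By Leibniz, the derivative of order `s + 1 ≤ n` of the combination times `1 / g n` involves
      -- only derivatives of the combination that vanish at `x`.
      rw [hev.iteratedDeriv_eq, ← iteratedDeriv_succ', iteratedDeriv_fun_mul]
      · refine Finset.sum_eq_zero fun j hj => ?_
        have hj := Finset.mem_range.1 hj
        rw [ha j (by omega), mul_zero, zero_mul]
      · refine ContDiffAt.sum fun i hi => contDiffAt_const.mul ?_
        exact ((hgs i (Finset.mem_range.1 hi)).contDiffAt (isOpen_Ioo.mem_nhds hx₁)).of_le
          (by exact_mod_cast hs)
      · exact (((hgs n (by omega)).contDiffAt (isOpen_Ioo.mem_nhds hx₁)).inv (hne x hx₁)).of_le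
          (by exact_mod_cast hs)
    intro i hi
    rcases Nat.lt_succ_iff_lt_or_eq.1 hi with h | h
    · exact hlt i h
    · subst h
      have h0 := ha 0 (Nat.succ_pos _)
      rw [iteratedDeriv_zero, Finset.sum_range_succ, Finset.sum_eq_zero, zero_add] at h0
      · exact (mul_eq_zero.1 h0).resolve_right (hne x hx₁)
      · intro j hj
        rw [hlt j (Finset.mem_range.1 hj), zero_mul]

/-- A family of functionals that separates the points of an `n`-dimensional space on every interval
`(p, r)` contains `n` functionals at increasing nodes that do so jointly. -/
theorem exists_strictMono_separating {V : Type*} [AddCommGroup V] [Module ℂ V]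
    [FiniteDimensional ℂ V] (g : ℚ → V →ₗ[ℂ] ℂ) {p₀ r : ℚ}
    (hg : ∀ p : ℚ, p₀ ≤ p → p < r → ∀ v ≠ 0, ∃ y : ℚ, p < y ∧ y < r ∧ g y v ≠ 0) (n : ℕ) :
    ∀ (p : ℚ) (W : Submodule ℂ V), p₀ ≤ p → p < r → Module.finrank ℂ W ≤ n →
    ∃ y : ℕ → ℚ, (∀ t, t + 1 < n → y t < y (t + 1)) ∧ (∀ t < n, p < y t ∧ y t < r) ∧
      ∀ v ∈ W, (∀ t < n, g (y t) v = 0) → v = 0 := by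
  induction n with
  | zero =>
    intro p W _ _ hW
    refine ⟨fun _ => 0, fun t ht => by omega, fun t ht => by omega, fun v hv _ => ?_⟩
    rw [Submodule.finrank_eq_zero.1 (Nat.le_zero.1 hW)] at hv
    exact (Submodule.mem_bot ℂ).1 hv
  | succ n ih =>
    intro p W hp hpr hW
    -- Greedy choice: a functional that is nonzero on some vector of `W` cuts the dimension. The
    -- next nodes are sought in `(y₀, r)`, which makes them increase.
    obtain ⟨y₀, hy1, hy2, hfin⟩ : ∃ y : ℚ, p < y ∧ y < r ∧
        Module.finrank ℂ (W ⊓ (g y).ker : Submodule ℂ V) ≤ n := by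
      by_cases hbot : W = ⊥
      · obtain ⟨y, h1, h2⟩ := exists_between hpr
        exact ⟨y, h1, h2, by rw [hbot, bot_inf_eq, finrank_bot]; exact Nat.zero_le n⟩
      · obtain ⟨v, hv, hv0⟩ := W.ne_bot_iff.1 hbot
        obtain ⟨y, h1, h2, h3⟩ := hg p hp hpr v hv0
        refine ⟨y, h1, h2, ?_⟩
        have : W ⊓ (g y).ker < W := by
          refine lt_of_le_of_ne inf_le_left fun h => h3 ?_
          rw [← h] at hv
          exact hv.2
        have := Submodule.finrank_lt_finrank_of_lt this
        omega
    obtain ⟨y, h1, h2, h3⟩ := ih y₀ _ (hp.trans hy1.le) hy2 hfin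
    refine ⟨fun t => Nat.casesOn t y₀ y, ?_, ?_, ?_⟩
    · intro t ht
      rcases t with _ | t
      · exact (h2 0 (by omega)).1
      · exact h1 t (by omega)
    · intro t ht
      rcases t with _ | t
      · exact ⟨hy1, hy2⟩
      · exact ⟨hy1.trans (h2 t (by omega)).1, (h2 t (by omega)).2⟩
    · intro v hv h
      exact h3 v ⟨hv, h 0 (by omega)⟩ fun t ht => h (t + 1) (by omega)

/-- Quantitative form of unique solvability: an injective linear map between finite-dimensional
spaces is bounded below. -/
theorem exists_bound_of_injective {d n : ℕ} (B : ℕ → ℕ → ℂ)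
    (hB : ∀ a : ℕ → ℂ, (∀ t < n, ∑ i ∈ Finset.range d, a i * B t i = 0) → ∀ i < d, a i = 0) :
    ∃ K : ℝ, 0 ≤ K ∧ ∀ (a : ℕ → ℂ) (ε : ℝ), 0 ≤ ε →
      (∀ t < n, ‖∑ i ∈ Finset.range d, a i * B t i‖ ≤ ε) → ∀ i < d, ‖a i‖ ≤ K * ε := by
  let T : (Fin d → ℂ) →ₗ[ℂ] (Fin n → ℂ) :=
    LinearMap.pi fun t => ∑ i : Fin d, (B t i) • LinearMap.proj i
  have hT : ∀ a : ℕ → ℂ, ∀ t : Fin n,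
      T (fun i => a i) t = ∑ i ∈ Finset.range d, a i * B t i := by
    intro a t
    rw [← Fin.sum_univ_eq_sum_range (fun i => a i * B t i)]
    simp [T, mul_comm]
  have hker : T.ker = ⊥ := by
    refine (Submodule.eq_bot_iff _).2 fun v hv => ?_
    let a : ℕ → ℂ := fun i => if h : i < d then v ⟨i, h⟩ else 0
    have hav : (fun i : Fin d => a i) = v := funext fun i => dif_pos i.2
    have h0 := hB a fun t ht => by
      rw [← hT a ⟨t, ht⟩, hav, LinearMap.mem_ker.1 hv, Pi.zero_apply]
    rw [← hav]
    exact funext fun i => h0 i i.2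
  obtain ⟨K, _, hK⟩ := T.exists_antilipschitzWith hker
  refine ⟨K, K.2, fun a ε hε h i hi => ?_⟩
  have h1 := hK.le_mul_dist (fun i => a i) 0
  rw [map_zero, dist_zero_right, dist_zero_right] at h1
  calc ‖a i‖ ≤ ‖fun i : Fin d => a i‖ := norm_le_pi_norm (fun i : Fin d => a i) ⟨i, hi⟩
    _ ≤ K * ‖T fun i => a i‖ := h1
    _ ≤ K * ε := by
      gcongr
      exact (pi_norm_le_iff_of_nonneg hε).2 fun t => by rw [hT]; exact h t t.2

variable {m : ℕ} {φ : ℝ → ℂ}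

/-- The `s`-th derivative of `φ (· + i)` at `x`. -/
noncomputable def shiftDeriv (φ : ℝ → ℂ) (s i : ℕ) (x : ℝ) : ℂ :=
  iteratedDeriv s (fun y => φ (y + i)) x

theorem IsLocalGenerator.contDiffAt (hG : IsLocalGenerator m φ) {s : ℕ} (hs : s ≤ m - 1) (i : ℕ)
    {x : ℝ} (hx : x ∈ Set.Ioo (0 : ℝ) 1) : ContDiffAt ℝ s (fun y => φ (y + i)) x :=
  ((hG.contDiffOn i).contDiffAt (isOpen_Ioo.mem_nhds hx)).of_le (by exact_mod_cast hs)

theorem IsLocalGenerator.iteratedDeriv_sum (hG : IsLocalGenerator m φ) {s : ℕ} (hs : s ≤ m - 1)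
    (d : ℕ) (a : ℕ → ℂ) {x : ℝ} (hx : x ∈ Set.Ioo (0 : ℝ) 1) :
    iteratedDeriv s (fun y => ∑ i ∈ Finset.range d, a i * φ (y + i)) x =
      ∑ i ∈ Finset.range d, a i * shiftDeriv φ s i x := by
  rw [iteratedDeriv_fun_sum fun i _ => contDiffAt_const.mul (hG.contDiffAt hs i hx)]
  exact Finset.sum_congr rfl fun i _ => iteratedDeriv_const_mul _ (hG.contDiffAt hs i hx)

/-- On the cell `[k, k + 1)` only the coefficients with indices in `(k - m, k]` matter. -/
theorem IsLocalGenerator.eq_sum_of_hasSum (hG : IsLocalGenerator m φ) {c : ℤ → ℂ} {f : ℝ → ℂ}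
    (hf : ∀ x : ℝ, HasSum (fun l : ℤ => c l * φ (x - l)) (f x)) (k : ℤ) {x : ℝ}
    (hx : x ∈ Set.Ico (k : ℝ) (k + 1)) :
    f x = ∑ i ∈ Finset.range m, c (k - i) * φ (x - k + i) := by
  refine (hf x).unique ?_
  have hinj : Set.InjOn (fun i : ℕ => k - (i : ℤ)) (Finset.range m) := fun i _ j _ h => by
    simp only at h; omega
  have h1 : ∑ i ∈ Finset.range m, c (k - i) * φ (x - k + i) =
      ∑ l ∈ (Finset.range m).image fun i : ℕ => k - (i : ℤ), c l * φ (x - l) := by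
    rw [Finset.sum_image hinj]
    refine Finset.sum_congr rfl fun i _ => ?_
    push_cast
    ring_nf
  rw [h1]
  refine hasSum_sum_of_ne_finset_zero fun l hl => ?_
  rcases lt_or_ge k l with h | h
  · have : (k : ℝ) + 1 ≤ l := by exact_mod_cast h
    rw [hG.eq_zero_of_neg _ (by linarith [hx.2]), mul_zero]
  · have h2 : (m : ℤ) ≤ k - l := by
      by_contra! hlt
      exact hl (Finset.mem_image.2 ⟨(k - l).toNat, Finset.mem_range.2 (by omega), by omega⟩)
    have h3 : (m : ℝ) ≤ k - l := by exact_mod_cast h2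
    rw [hG.eq_zero_of_ge _ (by linarith [hx.1]), mul_zero]

/-- A node inside a cell avoids the knots, so the right derivative there is the ordinary derivative
of a finite sum. -/
theorem IsLocalGenerator.rderiv_eq (hG : IsLocalGenerator m φ) {c : ℤ → ℂ} {f : ℝ → ℂ}
    (hf : ∀ x : ℝ, HasSum (fun l : ℤ => c l * φ (x - l)) (f x)) (k : ℤ) {θ : ℝ}
    (hθ : θ ∈ Set.Ioo (0 : ℝ) 1) {s : ℕ} (hs : s ≤ m - 1) :
    rderiv s f (k + θ) = ∑ i ∈ Finset.range m, c (k - i) * shiftDeriv φ s i θ := by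
  set F : ℝ → ℂ := fun y => ∑ i ∈ Finset.range m, c (k - i) * φ (y + i) with hF
  have hFc : ContDiffAt ℝ s F θ :=
    ContDiffAt.sum fun i _ => contDiffAt_const.mul (hG.contDiffAt hs i hθ)
  have hev : f =ᶠ[nhds (k + θ)] fun y => F (y - k) := by
    filter_upwards [Ioo_mem_nhds (show (k : ℝ) < k + θ by linarith [hθ.1])
      (show (k : ℝ) + θ < k + 1 by linarith [hθ.2])] with y hy
    exact hG.eq_sum_of_hasSum hf k ⟨hy.1.le, hy.2⟩
  have hc : ContDiffAt ℝ s (fun y => F (y - k)) (k + θ) := by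
    refine ContDiffAt.comp (k + θ) (g := F) ?_ (contDiffAt_id.sub contDiffAt_const)
    simpa using hFc
  rw [rderiv, iteratedDerivWithin_eq_iteratedDeriv (uniqueDiffOn_Ici _)
    (hc.congr_of_eventuallyEq hev) Set.self_mem_Ici, hev.iteratedDeriv_eq,
    iteratedDeriv_comp_sub_const]
  simp only [add_sub_cancel_left]
  exact hG.iteratedDeriv_sum hs m (fun i => c (k - i)) hθ

/-- `m` increasing rational nodes in `(0, 1)` that determine the `m` active coefficients. -/
theorem IsLocalGenerator.exists_nodes (hG : IsLocalGenerator m φ) :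
    ∃ y : ℕ → ℚ, (∀ t, t + 1 < m → y t < y (t + 1)) ∧ (∀ t < m, 0 < y t ∧ y t < 1) ∧
      ∃ K : ℝ, 0 ≤ K ∧ ∀ (a : ℕ → ℂ) (ε : ℝ), 0 ≤ ε →
        (∀ t < m, ‖∑ i ∈ Finset.range m, a i * shiftDeriv φ 0 i (y t)‖ ≤ ε) →
        ∀ i < m, ‖a i‖ ≤ K * ε := by
  let g : ℚ → (Fin m → ℂ) →ₗ[ℂ] ℂ := fun y => ∑ i : Fin m, φ ((y : ℝ) + (i : ℕ)) • LinearMap.proj i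
  have hgapp : ∀ (y : ℚ) (a : ℕ → ℂ),
      g y (fun i => a i) = ∑ i ∈ Finset.range m, a i * φ ((y : ℝ) + i) := by
    intro y a
    rw [← Fin.sum_univ_eq_sum_range (fun i => a i * φ ((y : ℝ) + i))]
    simp [g, mul_comm]
  have hext : ∀ v : Fin m → ℂ, ∃ a : ℕ → ℂ, (fun i : Fin m => a i) = v := fun v =>
    ⟨fun i => if h : i < m then v ⟨i, h⟩ else 0, funext fun i => dif_pos i.2⟩
  obtain ⟨y, h1, h2, h3⟩ := exists_strictMono_separating g (p₀ := 0) (r := 1)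
    (by
      intro p hp hp1 v hv
      obtain ⟨a, rfl⟩ := hext v
      have hex : ∃ x ∈ Set.Ioo (p : ℝ) 1, ∑ i ∈ Finset.range m, a i * φ (x + i) ≠ 0 := by
        by_contra! hall
        exact hv (funext fun i => hG.indep p 1 (by exact_mod_cast hp1) (by exact_mod_cast hp)
          le_rfl a hall i i.2)
      obtain ⟨x, hx, hx0⟩ := hex
      have hp' : (0 : ℝ) ≤ p := by exact_mod_cast hp
      -- Continuity moves the point of nonvanishing to a rational one; rational offsets are needed
      -- for the lattice.
      have hcont : ContinuousAt (fun x => ∑ i ∈ Finset.range m, a i * φ (x + i)) x := by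
        refine tendsto_finsetSum _ fun i _ => ContinuousAt.mul continuousAt_const ?_
        exact (hG.contDiffAt (Nat.zero_le _) i ⟨hp'.trans_lt hx.1, hx.2⟩).continuousAt
      have hev := (isOpen_Ioo.eventually_mem hx).and (hcont.eventually_ne hx0)
      obtain ⟨p₁, q₁, hx₁, hsub⟩ := mem_nhds_iff_exists_Ioo_subset.1 hev
      obtain ⟨y, hy1, hy2⟩ := exists_rat_btwn (hx₁.1.trans hx₁.2)
      obtain ⟨hy3, hy4⟩ := hsub ⟨hy1, hy2⟩
      exact ⟨y, by exact_mod_cast hy3.1, by exact_mod_cast hy3.2, by rw [hgapp]; exact hy4⟩)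
    m 0 ⊤ le_rfl zero_lt_one (by simp)
  refine ⟨y, h1, h2, exists_bound_of_injective (fun t i => shiftDeriv φ 0 i (y t)) ?_⟩
  intro a ha i hi
  have := h3 (fun i => a i) trivial fun t ht => by rw [hgapp]; exact ha t ht
  exact congrFun this ⟨i, hi⟩

/-- A rational node in `(0, 1)` at which `d` derivatives determine the `d` newest coefficients. -/
theorem IsLocalGenerator.exists_hermite_node (hG : IsLocalGenerator m φ) {d : ℕ} (hd : d ≤ m) :
    ∃ z : ℚ, 0 < z ∧ z < 1 ∧
      ∃ K : ℝ, 0 ≤ K ∧ ∀ (a : ℕ → ℂ) (ε : ℝ), 0 ≤ ε →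
        (∀ s < d, ‖∑ i ∈ Finset.range d, a i * shiftDeriv φ s i z‖ ≤ ε) →
        ∀ i < d, ‖a i‖ ≤ K * ε := by
  obtain ⟨p, q, hp, hpq, hq, h⟩ := exists_Ioo_wronskian_injective d (fun i x => φ (x + i)) 0 1
    zero_lt_one
    (fun i hi => (hG.contDiffOn i).of_le (by exact_mod_cast Nat.sub_le_sub_right hd 1))
    (by
      intro p q hp hpq hq a ha i hi
      -- Padding with zeros reduces a relation among the first `d` translates to one among all `m`.
      have := hG.indep p q hpq hp hq (fun i => if i < d then a i else 0)
        (fun x hx => by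
          refine Eq.trans ?_ (ha x hx)
          rw [← Finset.sum_subset (Finset.range_subset_range.2 hd)]
          · exact Finset.sum_congr rfl fun i hi => by rw [if_pos (Finset.mem_range.1 hi)]
          · intro i _ hi
            rw [if_neg (mt Finset.mem_range.2 hi), zero_mul])
        i (by omega)
      simpa [hi] using this)
  obtain ⟨z, hz1, hz2⟩ := exists_rat_btwn hpq
  have hz : (z : ℝ) ∈ Set.Ioo (0 : ℝ) 1 := ⟨hp.trans_lt hz1, hz2.trans_le hq⟩
  refine ⟨z, by exact_mod_cast hz.1, by exact_mod_cast hz.2,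
    exists_bound_of_injective (fun s i => shiftDeriv φ s i z) fun a ha => ?_⟩
  refine h z ⟨hz1, hz2⟩ a fun s hs => ?_
  rw [hG.iteratedDeriv_sum (by omega) d a hz]
  exact ha s hs

end ShiftInvariant

/-! ### From local estimates to `ℓ^p` and `L^p` norms -/

namespace ShiftInvariant

open MeasureTheory

/-- The `p`-th power of the `ℓ^p` norm of a family in `[0, ∞]`; its supremum if `p = ∞`. -/
noncomputable def pSum {ι : Type*} (p : ℝ≥0∞) (a : ι → ℝ≥0∞) : ℝ≥0∞ :=
  if p = ∞ then ⨆ i, a i else ∑' i, a i ^ p.toReal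

theorem pSum_top {ι : Type*} (a : ι → ℝ≥0∞) : pSum ∞ a = ⨆ i, a i := if_pos rfl

theorem pSum_of_ne_top {ι : Type*} {p : ℝ≥0∞} (hp : p ≠ ∞) (a : ι → ℝ≥0∞) :
    pSum p a = ∑' i, a i ^ p.toReal := if_neg hp

/-- If every `b k` is dominated by some `a i` with `R i k`, where every `i` is related to at most
`n` indices `k`, then `b` is dominated by `a` in `ℓ^p`. -/
theorem exists_pSum_le {ι κ : Type*} (p : ℝ≥0∞) (R : ι → κ → Prop) (n : ℕ)
    (hR : ∀ i, {k | R i k}.encard ≤ n) (C : ℝ≥0) :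
    ∃ D : ℝ≥0, 0 < D ∧ ∀ (a : ι → ℝ≥0∞) (b : κ → ℝ≥0∞),
      (∀ k, ∃ i, R i k ∧ b k ≤ C * a i) → pSum p b ≤ D * pSum p a := by
  classical
  by_cases hp : p = ∞
  · subst hp
    refine ⟨C + 1, by positivity, fun a b h => ?_⟩
    rw [pSum_top, pSum_top]
    refine iSup_le fun k => ?_
    obtain ⟨i, -, hi⟩ := h k
    refine hi.trans (mul_le_mul' ?_ (le_iSup a i))
    exact_mod_cast (le_add_of_nonneg_right zero_le_one : C ≤ C + 1)
  · refine ⟨n * C ^ p.toReal + 1, by positivity, fun a b h => ?_⟩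
    rw [pSum_of_ne_top hp, pSum_of_ne_top hp]
    have hp0 : 0 ≤ p.toReal := ENNReal.toReal_nonneg
    -- The dominating index is replaced by the sum over all related `i`. After exchanging the sums
    -- each `a i` is counted at most `n` times.
    have h1 : ∀ k, b k ^ p.toReal ≤
        ∑' i, Set.indicator {k | R i k} (fun _ => (C : ℝ≥0∞) ^ p.toReal * a i ^ p.toReal) k := by
      intro k
      obtain ⟨i, hi, hb⟩ := h k
      refine le_trans ?_ (ENNReal.le_tsum i)
      rw [Set.indicator_of_mem (show k ∈ {k | R i k} from hi), ← ENNReal.mul_rpow_of_nonneg _ _ hp0]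
      exact ENNReal.rpow_le_rpow hb hp0
    calc ∑' k, b k ^ p.toReal
        ≤ ∑' k, ∑' i, Set.indicator {k | R i k}
            (fun _ => (C : ℝ≥0∞) ^ p.toReal * a i ^ p.toReal) k := ENNReal.tsum_le_tsum h1
      _ = ∑' i, ∑' k, Set.indicator {k | R i k}
            (fun _ => (C : ℝ≥0∞) ^ p.toReal * a i ^ p.toReal) k := ENNReal.tsum_comm
      _ ≤ ∑' i, (n * (C : ℝ≥0∞) ^ p.toReal + 1) * a i ^ p.toReal := by
        refine ENNReal.tsum_le_tsum fun i => ?_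
        rw [← tsum_subtype {k | R i k} (fun _ => (C : ℝ≥0∞) ^ p.toReal * a i ^ p.toReal),
          ENNReal.tsum_set_const, ← mul_assoc]
        refine mul_le_mul' (le_trans (mul_le_mul' ?_ le_rfl) le_self_add) le_rfl
        exact_mod_cast hR i
      _ = _ := by
        rw [ENNReal.tsum_mul_left]
        congr 1
        push_cast
        rw [ENNReal.coe_rpow_of_nonneg _ hp0]

/-- The `p`-th power of the `L^p` norm is the sum of the `p`-th powers of the norms over the unit
cells; for `p = ∞` it is the supremum. -/
theorem pSum_eLpNorm_cells {p : ℝ≥0∞} (hp : 1 ≤ p) (f : ℝ → ℂ) :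
    pSum p (fun k : ℤ => eLpNorm f p (volume.restrict (Set.Ico (k : ℝ) (k + 1)))) =
      if p = ∞ then eLpNorm f ∞ volume else eLpNorm f p volume ^ p.toReal := by
  have hp0 : p ≠ 0 := (zero_lt_one.trans_le hp).ne'
  split_ifs with h
  · subst h
    rw [pSum_top]
    refine le_antisymm (iSup_le fun k => eLpNorm_restrict_le _ _ _ _) ?_
    simp only [eLpNorm_exponent_top]
    refine essSup_le_of_ae_le _ ?_
    have : ∀ᵐ x ∂(volume : Measure ℝ).restrict (⋃ k : ℤ, Set.Ico (k : ℝ) (k + 1)), ‖f x‖ₑ ≤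
        ⨆ k : ℤ, eLpNormEssSup f (volume.restrict (Set.Ico (k : ℝ) (k + 1))) := by
      rw [ae_restrict_iUnion_iff]
      intro k
      filter_upwards [ae_le_eLpNormEssSup (f := f)
        (μ := volume.restrict (Set.Ico (k : ℝ) (k + 1)))] with x hx
      exact hx.trans (le_iSup
        (fun k : ℤ => eLpNormEssSup f (volume.restrict (Set.Ico (k : ℝ) (k + 1)))) k)
    rwa [iUnion_Ico_intCast, Measure.restrict_univ] at this
  · have hpr : p.toReal ≠ 0 := (ENNReal.toReal_pos hp0 h).ne'
    rw [pSum_of_ne_top h]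
    simp_rw [eLpNorm_eq_lintegral_rpow_enorm_toReal hp0 h, ← ENNReal.rpow_mul,
      one_div_mul_cancel hpr, ENNReal.rpow_one]
    rw [← lintegral_iUnion (fun k => measurableSet_Ico) (Set.pairwise_disjoint_Ico_intCast ℝ),
      iUnion_Ico_intCast, Measure.restrict_univ]

variable {m : ℕ} {φ : ℝ → ℂ}

theorem IsLocalGenerator.exists_bound (hG : IsLocalGenerator m φ) :
    ∃ B : ℝ, 0 ≤ B ∧ ∀ i < m, ∀ x ∈ Set.Ico (0 : ℝ) 1, ‖φ (x + i)‖ ≤ B := by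
  have h1 : ∀ i : ℕ, ∃ B : ℝ, 0 ≤ B ∧ ∀ x ∈ Set.Ico (0 : ℝ) 1, ‖φ (x + i)‖ ≤ B := by
    intro i
    obtain ⟨e, he, hφe⟩ := hG.exists_continuous i
    obtain ⟨B, hB⟩ := (isCompact_Icc (a := (0 : ℝ)) (b := 1)).exists_bound_of_continuousOn
      he.continuousOn
    exact ⟨B, (norm_nonneg _).trans (hB 0 (by simp)), fun x hx => by
      rw [hφe x hx]; exact hB x ⟨hx.1, hx.2.le⟩⟩
  choose B hB0 hB using h1
  refine ⟨∑ i ∈ Finset.range m, B i, Finset.sum_nonneg fun i _ => hB0 i, fun i hi x hx => ?_⟩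
  exact (hB i x hx).trans
    (Finset.single_le_sum (f := B) (fun i _ => hB0 i) (Finset.mem_range.2 hi))

theorem IsLocalGenerator.memLp (hG : IsLocalGenerator m φ) (p : ℝ≥0∞) (a : ℕ → ℂ) :
    MemLp (fun x : ℝ => ∑ i ∈ Finset.range m, a i * φ (x + i)) p
      (volume.restrict (Set.Ico (0 : ℝ) 1)) := by
  refine memLp_finsetSum _ fun i hi => MemLp.const_mul ?_ (a i)
  obtain ⟨e, he, hφe⟩ := hG.exists_continuous i
  obtain ⟨B, -, hB⟩ := hG.exists_bound
  have hae : e =ᵐ[volume.restrict (Set.Ico (0 : ℝ) 1)] fun x => φ (x + i) := by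
    filter_upwards [ae_restrict_mem measurableSet_Ico] with x hx using (hφe x hx).symm
  refine MemLp.of_bound (he.aestronglyMeasurable.congr hae) B ?_
  filter_upwards [ae_restrict_mem measurableSet_Ico] with x hx
  exact hB i (Finset.mem_range.1 hi) x hx

/-- The `L^p` norm on a cell is bounded by the active coefficients. -/
theorem IsLocalGenerator.exists_eLpNorm_cell_le (hG : IsLocalGenerator m φ) :
    ∃ C : ℝ≥0, ∀ (p : ℝ≥0∞) (c : ℤ → ℂ) (f : ℝ → ℂ),
      (∀ x : ℝ, HasSum (fun l : ℤ => c l * φ (x - l)) (f x)) → ∀ (k : ℤ) (M : ℝ),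
      (∀ i < m, ‖c (k - i)‖ ≤ M) →
      eLpNorm f p (volume.restrict (Set.Ico (k : ℝ) (k + 1))) ≤ C * ENNReal.ofReal M := by
  obtain ⟨B, hB0, hB⟩ := hG.exists_bound
  refine ⟨(m * B).toNNReal, fun p c f hf k M hM => ?_⟩
  have hb : ∀ᵐ x ∂volume.restrict (Set.Ico (k : ℝ) (k + 1)), ‖f x‖ ≤ (m * B) * M := by
    filter_upwards [ae_restrict_mem measurableSet_Ico] with x hx
    rw [hG.eq_sum_of_hasSum hf k hx]
    refine (norm_sum_le_of_le _ (f := fun i : ℕ => c (k - i) * φ (x - k + i)) (n := fun _ => M * B)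
      fun i hi => ?_).trans ?_
    · have hi := Finset.mem_range.1 hi
      rw [norm_mul]
      exact mul_le_mul (hM i hi) (hB i hi _ ⟨by linarith [hx.1], by linarith [hx.2]⟩)
        (norm_nonneg _) ((norm_nonneg _).trans (hM i hi))
    · rw [Finset.sum_const, Finset.card_range, nsmul_eq_mul]
      exact le_of_eq (by ring)
  refine (eLpNorm_le_of_ae_bound hb).trans ?_
  rw [Measure.restrict_apply_univ, Real.volume_Ico, add_sub_cancel_left, ENNReal.ofReal_one,
    ENNReal.one_rpow, one_mul, ENNReal.ofReal_mul (by positivity)]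
  exact le_rfl

/-- The active coefficients are bounded by the `L^p` norm on a cell. -/
theorem IsLocalGenerator.exists_coeff_le_eLpNorm_cell (hG : IsLocalGenerator m φ) {p : ℝ≥0∞}
    (hp : 1 ≤ p) :
    ∃ C : ℝ≥0, ∀ (c : ℤ → ℂ) (f : ℝ → ℂ),
      (∀ x : ℝ, HasSum (fun l : ℤ => c l * φ (x - l)) (f x)) → ∀ (k : ℤ), ∀ i < m,
      ‖c (k - i)‖ₑ ≤ C * eLpNorm f p (volume.restrict (Set.Ico (k : ℝ) (k + 1))) := by
  have : Fact (1 ≤ p) := ⟨hp⟩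
  set ν := (volume : Measure ℝ).restrict (Set.Ico (0 : ℝ) 1) with hν
  let ext : (Fin m → ℂ) → ℕ → ℂ := fun v i => if h : i < m then v ⟨i, h⟩ else 0
  -- The map from active coefficients to functions on the unit cell is injective by local
  -- independence, hence bounded below; translation carries the constant to every cell.
  let T : (Fin m → ℂ) →ₗ[ℂ] Lp ℂ p ν :=
    { toFun := fun v => (hG.memLp p (ext v)).toLp _
      map_add' := by
        intro u v
        rw [← MemLp.toLp_add]
        refine MemLp.toLp_congr _ _ (Filter.EventuallyEq.of_eq (funext fun x => ?_))
        rw [Pi.add_apply, ← Finset.sum_add_distrib]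
        refine Finset.sum_congr rfl fun i hi => ?_
        simp only [ext, dif_pos (Finset.mem_range.1 hi), Pi.add_apply, add_mul]
      map_smul' := by
        intro r v
        rw [RingHom.id_apply, ← MemLp.toLp_const_smul]
        refine MemLp.toLp_congr _ _ (Filter.EventuallyEq.of_eq (funext fun x => ?_))
        rw [Pi.smul_apply, Finset.smul_sum]
        refine Finset.sum_congr rfl fun i hi => ?_
        simp only [ext, dif_pos (Finset.mem_range.1 hi), Pi.smul_apply, smul_eq_mul, mul_assoc] }
  have hker : T.ker = ⊥ := by
    refine (Submodule.eq_bot_iff _).2 fun v hv => ?_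
    have h0 : (fun x : ℝ => ∑ i ∈ Finset.range m, ext v i * φ (x + i)) =ᵐ[ν] fun _ => 0 :=
      (MemLp.coeFn_toLp (hG.memLp p (ext v))).symm.trans
        (by rw [show (hG.memLp p (ext v)).toLp _ = 0 from hv]; exact Lp.coeFn_zero _ _ _)
    have h1 := Measure.eqOn_Ioo_of_ae_eq volume
      (ae_mono (Measure.restrict_mono Set.Ioo_subset_Ico_self le_rfl) h0)
      (continuousOn_finsetSum _ fun i _ => continuousOn_const.mul (hG.contDiffOn i).continuousOn)
      continuousOn_const
    have h2 := hG.indep 0 1 zero_lt_one le_rfl le_rfl (ext v) h1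
    funext i
    have := h2 i i.2
    simpa [ext] using this
  obtain ⟨K, -, hK⟩ := T.exists_antilipschitzWith hker
  refine ⟨K, fun c f hf k i hi => ?_⟩
  have hFm := hG.memLp p fun i => c (k - i)
  have hmp : MeasurePreserving (fun x : ℝ => x - k)
      (volume.restrict (Set.Ico (k : ℝ) (k + 1))) ν := by
    have := (measurePreserving_sub_right (volume : Measure ℝ) (k : ℝ)).restrict_preimage
      (measurableSet_Ico (a := (0 : ℝ)) (b := 1))
    rwa [show (fun x : ℝ => x - k) ⁻¹' Set.Ico (0 : ℝ) 1 = Set.Ico (k : ℝ) (k + 1) by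
      rw [Set.preimage_sub_const_Ico, zero_add, add_comm]] at this
  have hnorm : eLpNorm f p (volume.restrict (Set.Ico (k : ℝ) (k + 1))) =
      eLpNorm (fun x : ℝ => ∑ i ∈ Finset.range m, c (k - i) * φ (x + i)) p ν := by
    rw [← eLpNorm_comp_measurePreserving hFm.1 hmp]
    refine eLpNorm_congr_ae ?_
    filter_upwards [ae_restrict_mem measurableSet_Ico] with x hx
    exact hG.eq_sum_of_hasSum hf k hx
  let v : Fin m → ℂ := fun i => c (k - (i : ℕ))
  have h1 := hK.le_mul_dist v 0
  rw [map_zero, dist_zero_right, dist_zero_right] at h1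
  have h2 : ‖T v‖ = (eLpNorm (fun x : ℝ => ∑ i ∈ Finset.range m, c (k - i) * φ (x + i)) p ν).toReal
      := by
    refine (Lp.norm_toLp _ (hG.memLp p (ext v))).trans ?_
    congr 2
    funext x
    exact Finset.sum_congr rfl fun i hi => by
      simp only [ext, v, dif_pos (Finset.mem_range.1 hi)]
  have h3 : ‖c (k - i)‖ ≤ K * ‖T v‖ := (norm_le_pi_norm v ⟨i, hi⟩).trans h1
  rw [hnorm, ← ENNReal.ofReal_toReal hFm.2.ne, ← h2, ← ENNReal.ofReal_coe_nnreal,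
    ← ENNReal.ofReal_mul K.coe_nonneg, ← ofReal_norm]
  exact ENNReal.ofReal_le_ofReal h3

end ShiftInvariant

/-! ### The sampling inequalities from uniform local bounds -/

namespace ShiftInvariant

open MeasureTheory

/-- Indexing the data by pairs of sample and derivative order lets `exists_pSum_le` treat all
exponents at once. -/
theorem pSum_samples {x : ℤ → ℝ} (hx : Function.Injective x) {μ : ℤ → ℕ} {μX : Set.range x → ℕ}
    (hμX : ∀ j, μX ⟨x j, Set.mem_range_self j⟩ = μ j) (p : ℝ≥0∞) (f : ℝ → ℂ) :
    pSum p (fun i : Σ j : ℤ, Fin (μ j + 1) => ‖rderiv i.2 f (x i.1)‖ₑ) =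
      if p = ∞ then ⨆ y : Set.range x, ⨆ s ∈ Finset.range (μX y + 1), ‖rderiv s f y‖ₑ
      else ∑' y : Set.range x, ∑ s ∈ Finset.range (μX y + 1), ‖rderiv s f y‖ₑ ^ p.toReal := by
  split_ifs with h
  · subst h
    rw [pSum_top, iSup_sigma, ← (Equiv.ofInjective x hx).iSup_comp]
    refine iSup_congr fun j => ?_
    rw [show Equiv.ofInjective x hx j = ⟨x j, Set.mem_range_self j⟩ from rfl, hμX]
    refine le_antisymm (iSup_le fun s => ?_) (iSup₂_le fun s hs => ?_)
    · exact le_iSup₂_of_le (f := fun s (_ : s ∈ Finset.range (μ j + 1)) => ‖rderiv s f (x j)‖ₑ)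
        (s : ℕ) (Finset.mem_range.2 s.2) le_rfl
    · exact le_iSup_of_le (f := fun s : Fin (μ j + 1) => ‖rderiv s f (x j)‖ₑ)
        ⟨s, Finset.mem_range.1 hs⟩ le_rfl
  · rw [pSum_of_ne_top h,
      ENNReal.tsum_sigma (fun j (s : Fin (μ j + 1)) => ‖rderiv s f (x j)‖ₑ ^ p.toReal),
      ← (Equiv.ofInjective x hx).tsum_eq]
    refine tsum_congr fun j => ?_
    rw [show Equiv.ofInjective x hx j = ⟨x j, Set.mem_range_self j⟩ from rfl, hμX, tsum_fintype,
      Fin.sum_univ_eq_sum_range (fun s => ‖rderiv s f (x j)‖ₑ ^ p.toReal)]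

variable {m : ℕ} {φ : ℝ → ℂ}

/-- Local estimates between coefficients and samples, uniform over the cells, imply that the samples
form a sampling set for all `p`. -/
theorem IsLocalGenerator.isSampling (hG : IsLocalGenerator m φ) {x : ℤ → ℝ}
    (hx : Function.Injective x) {μ : ℤ → ℕ} (hμ : ∀ j, μ j ≤ m - 1) {μX : Set.range x → ℕ}
    (hμX : ∀ j, μX ⟨x j, Set.mem_range_self j⟩ = μ j) (k : ℤ → ℤ) (H n : ℕ)
    (hcount : ∀ κ, {j | k j = κ}.encard ≤ n) (C₁ C₂ : ℝ≥0)
    (hlow : ∀ (c : ℤ → ℂ) (f : ℝ → ℂ), (∀ x : ℝ, HasSum (fun l : ℤ => c l * φ (x - l)) (f x)) →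
      ∀ κ : ℤ, ∃ j, ∃ s ≤ μ j, |k j - κ| ≤ H ∧ ∀ i < m, ‖c (κ - i)‖ ≤ C₁ * ‖rderiv s f (x j)‖)
    (hup : ∀ (c : ℤ → ℂ) (f : ℝ → ℂ), (∀ x : ℝ, HasSum (fun l : ℤ => c l * φ (x - l)) (f x)) →
      ∀ j, ∀ s ≤ μ j, ∃ i < m, ‖rderiv s f (x j)‖ ≤ C₂ * ‖c (k j - i)‖)
    {p : ℝ≥0∞} (hp : 1 ≤ p) : IsSampling p φ (Set.range x) μX := by
  obtain ⟨C₃, hC₃⟩ := hG.exists_eLpNorm_cell_le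
  obtain ⟨C₄, hC₄⟩ := hG.exists_coeff_le_eLpNorm_cell hp
  obtain ⟨D₁, hD₁, h₁⟩ := exists_pSum_le (ι := Σ j : ℤ, Fin (μ j + 1)) (κ := ℤ) p
    (fun i κ => |k i.1 - κ| ≤ H) (2 * H + 1)
    (by
      intro i
      have : {κ : ℤ | |k i.1 - κ| ≤ H} ⊆ Finset.Icc (k i.1 - H) (k i.1 + H) := by
        intro κ hκ
        have := abs_le.1 (show |k i.1 - κ| ≤ H from hκ)
        rw [Finset.coe_Icc]
        exact ⟨by omega, by omega⟩
      refine (Set.encard_le_encard this).trans ?_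
      rw [Set.encard_coe_eq_coe_finsetCard, Int.card_Icc]
      norm_cast
      omega) (C₃ * C₁)
  obtain ⟨D₂, hD₂, h₂⟩ := exists_pSum_le (ι := ℤ) (κ := Σ j : ℤ, Fin (μ j + 1)) p
    (fun κ i => k i.1 = κ) (n * m)
    (by
      intro κ
      have : {i : Σ j : ℤ, Fin (μ j + 1) | k i.1 = κ}.encard ≤
          ({j | k j = κ} ×ˢ (Finset.range m : Set ℕ)).encard := by
        refine Set.encard_le_encard_of_injOn (f := fun i => (i.1, (i.2 : ℕ))) ?_ ?_
        · rintro ⟨j, s⟩ hj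
          refine ⟨hj, ?_⟩
          have h1 := hμ j
          have h2 := s.2
          rw [Finset.mem_coe, Finset.mem_range]
          by_contra! hlt
          -- Truncated subtraction allows `μ j = 0` when `m = 0`; that case is excluded by `hup`,
          -- applied to the zero function, since it supplies an index below `m`.
          have h3 : (s : ℕ) = 0 ∧ m = 0 := by simp only at hlt h2; omega
          obtain ⟨i, hi, -⟩ := hup 0 0 (fun x => by simp) j s (by omega)
          omega
        · rintro ⟨j, s⟩ _ ⟨j', s'⟩ _ h
          simp only [Prod.mk.injEq] at h
          obtain ⟨rfl, h⟩ := h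
          rw [Fin.ext h]
      refine this.trans ?_
      rw [Set.encard_prod, Set.encard_coe_eq_coe_finsetCard, Finset.card_range]
      push_cast
      exact mul_le_mul' (hcount κ) le_rfl) (C₂ * C₄)
  refine ⟨D₁⁻¹, D₂, inv_pos.2 hD₁, hD₂, ?_⟩
  rintro f ⟨-, c, -, hf⟩
  have e₁ := pSum_eLpNorm_cells hp f
  have e₂ := pSum_samples hx hμX p f
  have low := h₁ (fun i => ‖rderiv i.2 f (x i.1)‖ₑ)
    (fun κ : ℤ => eLpNorm f p (volume.restrict (Set.Ico (κ : ℝ) (κ + 1)))) (by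
      intro κ
      obtain ⟨j, s, hs, hj, hc⟩ := hlow c f hf κ
      refine ⟨⟨j, ⟨s, by omega⟩⟩, hj, (hC₃ p c f hf κ _ hc).trans (le_of_eq ?_)⟩
      rw [ENNReal.ofReal_mul C₁.coe_nonneg, ENNReal.ofReal_coe_nnreal, ofReal_norm, ENNReal.coe_mul,
        mul_assoc])
  have up := h₂ (fun κ : ℤ => eLpNorm f p (volume.restrict (Set.Ico (κ : ℝ) (κ + 1))))
    (fun i => ‖rderiv i.2 f (x i.1)‖ₑ) (by
      rintro ⟨j, s⟩
      obtain ⟨i, hi, h⟩ := hup c f hf j s (by omega)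
      refine ⟨k j, rfl, ?_⟩
      have h' : ‖rderiv s f (x j)‖ₑ ≤ C₂ * ‖c (k j - i)‖ₑ := by
        rw [← ofReal_norm, ← ofReal_norm, ← ENNReal.ofReal_coe_nnreal,
          ← ENNReal.ofReal_mul C₂.coe_nonneg]
        exact ENNReal.ofReal_le_ofReal h
      refine h'.trans ?_
      rw [ENNReal.coe_mul, mul_assoc]
      exact mul_le_mul' le_rfl (hC₄ c f hf (k j) i hi))
  rw [e₁, e₂] at low
  rw [e₁, e₂] at up
  have hD0 : (D₁ : ℝ≥0∞) ≠ 0 := by exact_mod_cast hD₁.ne'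
  rw [ENNReal.coe_inv hD₁.ne']
  split_ifs at low up ⊢
  · exact ⟨(ENNReal.inv_mul_le_iff hD0 ENNReal.coe_ne_top).2 low, up⟩
  · exact ⟨(ENNReal.inv_mul_le_iff hD0 ENNReal.coe_ne_top).2 low, up⟩

/-! ### Layout of the samples in cells and blocks -/

/-- The sample with index `j` lies in the cell `[k j, k j + 1)`. Blocks of `M` consecutive samples
start with a cluster of `m` samples in one new cell; every later sample advances by as many cells
as it carries data. -/
structure IsLayout (m M : ℕ) (μ : ℤ → ℕ) (k : ℤ → ℤ) : Prop where
  start : ∀ b : ℤ, k (b * M) = k (b * M - 1) + 1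
  cluster : ∀ (b : ℤ) (r : ℕ), 0 < r → r < m → k (b * M + r) = k (b * M + r - 1)
  step : ∀ (b : ℤ) (r : ℕ), m ≤ r → r < M →
    k (b * M + r) = k (b * M + r - 1) + (μ (b * M + r) + 1)

theorem exists_eq_sub_one_add (δ : ℤ → ℤ) : ∃ k : ℤ → ℤ, ∀ j, k j = k (j - 1) + δ j := by
  refine ⟨fun j => ∑ i ∈ Finset.Ioc 0 j, δ i - ∑ i ∈ Finset.Ioc j 0, δ i, fun j => ?_⟩
  simp only
  rcases lt_or_ge 0 j with h | h
  · have h1 : Finset.Ioc 0 j = insert j (Finset.Ioc 0 (j - 1)) := by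
      ext i; simp only [Finset.mem_Ioc, Finset.mem_insert]; omega
    rw [h1, Finset.sum_insert (by simp), Finset.Ioc_eq_empty (by omega : ¬ j < 0),
      Finset.Ioc_eq_empty (by omega : ¬ j - 1 < 0)]
    simp only [Finset.sum_empty]
    ring
  · have h1 : Finset.Ioc (j - 1) 0 = insert j (Finset.Ioc j 0) := by
      ext i; simp only [Finset.mem_Ioc, Finset.mem_insert]; omega
    rw [h1, Finset.sum_insert (by simp), Finset.Ioc_eq_empty (by omega : ¬ (0 : ℤ) < j),
      Finset.Ioc_eq_empty (by omega : ¬ (0 : ℤ) < j - 1)]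
    simp only [Finset.sum_empty]
    ring

theorem emod_block {M r : ℕ} (hr : r < M) (b : ℤ) : (b * M + r) % (M : ℤ) = r := by
  rw [Int.mul_add_emod_self_right]
  exact Int.emod_eq_of_lt (by positivity) (by exact_mod_cast hr)

theorem exists_block {M : ℕ} (hM : 0 < M) (j : ℤ) : ∃ (b : ℤ) (r : ℕ), r < M ∧ j = b * M + r := by
  have hM' : (0 : ℤ) < M := by exact_mod_cast hM
  have h1 := Int.emod_nonneg j hM'.ne'
  have h2 := Int.emod_lt_of_pos j hM'
  refine ⟨j / M, (j % M).toNat, by omega, ?_⟩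
  rw [Int.toNat_of_nonneg h1, mul_comm]
  exact (Int.mul_ediv_add_emod j M).symm

theorem exists_isLayout {m M : ℕ} (hm : 1 ≤ m) (hM : m ≤ M) (μ : ℤ → ℕ) :
    ∃ k, IsLayout m M μ k := by
  obtain ⟨k, hk⟩ := exists_eq_sub_one_add fun j =>
    if j % (M : ℤ) = 0 then 1 else if j % (M : ℤ) < m then 0 else μ j + 1
  refine ⟨k, fun b => ?_, fun b r h1 h2 => ?_, fun b r h1 h2 => ?_⟩
  · rw [hk, if_pos (by simp)]
  · rw [hk, emod_block (by omega), if_neg (by omega), if_pos (by omega), add_zero]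
  · rw [hk, emod_block h2, if_neg (by omega), if_neg (by omega)]

namespace IsLayout

variable {M : ℕ} {μ : ℤ → ℕ} {k : ℤ → ℤ}

theorem eq_start (L : IsLayout m M μ k) (b : ℤ) {r : ℕ} (hr : r < m) :
    k (b * M + r) = k (b * M) := by
  induction r with
  | zero => simp
  | succ r ih =>
    rw [L.cluster b (r + 1) (by omega) hr, ← ih (by omega)]
    congr 1
    push_cast
    ring

theorem monotone (L : IsLayout m M μ k) (hM : 0 < M) : Monotone k := by
  refine monotone_int_of_le_succ fun j => ?_
  obtain ⟨b, r, hr, h⟩ := exists_block hM (j + 1)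
  rw [h, show j = b * M + r - 1 by omega]
  rcases Nat.eq_zero_or_pos r with h0 | h0
  · subst h0
    have := L.start b
    simp only [Nat.cast_zero, add_zero]
    omega
  · rcases Nat.lt_or_ge r m with h1 | h1
    · exact (L.cluster b r h0 h1).ge
    · rw [L.step b r h1 hr]; omega

/-- The coefficients that are active in a block are bounded by the samples of the block, where
`B s i j` is the contribution of a coefficient to the `s`-th derivative at the sample `j`. -/
theorem exists_block_bound (L : IsLayout m M μ k) (hm : 1 ≤ m) (hM : m ≤ M)
    (hμ : ∀ j, μ j ≤ m - 1) (B : ℕ → ℕ → ℤ → ℂ) {K₁ K₂ D : ℝ} (hK₁ : 0 ≤ K₁) (hK₂ : 0 ≤ K₂)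
    (hD0 : 0 ≤ D) (hD : ∀ j, ∀ s < m, ∀ i < m, ‖B s i j‖ ≤ D)
    (h₁ : ∀ (b : ℤ) (a : ℕ → ℂ) (ε : ℝ), 0 ≤ ε →
      (∀ t < m, ‖∑ i ∈ Finset.range m, a i * B 0 i (b * M + (t : ℕ))‖ ≤ ε) →
      ∀ i < m, ‖a i‖ ≤ K₁ * ε)
    (h₂ : ∀ (b : ℤ) (r : ℕ), m ≤ r → r < M → ∀ (a : ℕ → ℂ) (ε : ℝ), 0 ≤ ε →
      (∀ s < μ (b * M + r) + 1,
        ‖∑ i ∈ Finset.range (μ (b * M + r) + 1), a i * B s i (b * M + r)‖ ≤ ε) →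
      ∀ i < μ (b * M + r) + 1, ‖a i‖ ≤ K₂ * ε) :
    ∀ t : ℕ, m - 1 ≤ t → t < M → ∃ C : ℝ, 0 ≤ C ∧ ∀ (c : ℤ → ℂ) (b : ℤ) (ε : ℝ), 0 ≤ ε →
      (∀ r < M, ∀ s ≤ μ (b * M + (r : ℕ)),
        ‖∑ i ∈ Finset.range m, c (k (b * M + r) - i) * B s i (b * M + r)‖ ≤ ε) →
      ∀ l, k (b * M) - m < l → l ≤ k (b * M + t) → ‖c l‖ ≤ C * ε := by
  intro t ht
  induction t, ht using Nat.le_induction with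
  | base =>
    intro _
    -- The opening cluster has all its nodes in one cell, and its function values alone control the
    -- `m` coefficients active there.
    refine ⟨K₁, hK₁, fun c b ε hε hs l hl1 hl2 => ?_⟩
    rw [L.eq_start b (by omega)] at hl2
    have := h₁ b (fun i => c (k (b * M) - i)) ε hε (fun t ht => by
      rw [← L.eq_start b ht]
      exact hs t (by omega) 0 (Nat.zero_le _)) (k (b * M) - l).toNat (by omega)
    rwa [Int.toNat_of_nonneg (by omega), sub_sub_cancel] at this
  | succ t ht ih =>
    intro htM
    obtain ⟨C, hC, hb⟩ := ih (by omega)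
    -- The old coefficients contribute at most `m` terms of size `C * ε * D` to a datum. Subtracting
    -- them leaves data of size `(1 + m * (C * D)) * ε`, from which the `μ j + 1` new coefficients
    -- are recovered at the cost of `K₂`.
    refine ⟨C + K₂ * (1 + m * (C * D)), by positivity, fun c b ε hε hs l hl1 hl2 => ?_⟩
    have hprev := hb c b ε hε hs
    have hCε : 0 ≤ C * ε := mul_nonneg hC hε
    rcases le_or_gt l (k (b * M + t)) with h | h
    · refine (hprev l hl1 h).trans (mul_le_mul_of_nonneg_right ?_ hε)
      have : 0 ≤ K₂ * (1 + m * (C * D)) := by positivity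
      linarith
    have hstep := L.step b (t + 1) (by omega) htM
    rw [show b * (M : ℤ) + ((t + 1 : ℕ) : ℤ) - 1 = b * M + t by push_cast; ring] at hstep
    have hmono : k (b * M) ≤ k (b * M + t) := L.monotone (by omega) (by omega)
    set j := b * (M : ℤ) + ((t + 1 : ℕ) : ℤ) with hj
    have hdm : μ j + 1 ≤ m := by have := hμ j; omega
    have hnew := h₂ b (t + 1) (by omega) htM (fun i => c (k j - i)) ((1 + m * (C * D)) * ε)
      (by positivity)
      (fun s hsμ => by
        rw [← hj] at hsμ
        have hsplit := Finset.sum_range_add_sum_Ico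
          (fun i : ℕ => c (k j - i) * B s i j) hdm
        rw [← hj, eq_sub_of_add_eq hsplit]
        refine (norm_sub_le _ _).trans ?_
        rw [add_mul, one_mul]
        refine add_le_add (hs (t + 1) htM s (Nat.lt_succ_iff.1 hsμ)) ?_
        refine (norm_sum_le_of_le _ (n := fun _ => C * ε * D) fun i hi => ?_).trans ?_
        · have hi := Finset.mem_Ico.1 hi
          rw [norm_mul]
          exact mul_le_mul (hprev _ (by omega) (by omega)) (hD j s (by omega) i hi.2)
            (norm_nonneg _) hCε
        · rw [Finset.sum_const, Nat.card_Ico, nsmul_eq_mul]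
          have h1 : ((m - (μ j + 1) : ℕ) : ℝ) ≤ m := by exact_mod_cast Nat.sub_le _ _
          calc ((m - (μ j + 1) : ℕ) : ℝ) * (C * ε * D) ≤ m * (C * ε * D) :=
                mul_le_mul_of_nonneg_right h1 (by positivity)
            _ = m * (C * D) * ε := by ring)
      (k j - l).toNat (by rw [← hj]; omega)
    rw [Int.toNat_of_nonneg (by omega), sub_sub_cancel] at hnew
    refine hnew.trans ?_
    rw [← mul_assoc]
    exact mul_le_mul_of_nonneg_right (by linarith) hε

/-- Every cell belongs to a block. -/
theorem exists_block_of_cell (L : IsLayout m M μ k) (hM : 0 < M) (κ : ℤ) :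
    ∃ b : ℤ, k (b * M) ≤ κ ∧ κ ≤ k (b * M + (M - 1 : ℕ)) := by
  have hstep : ∀ b : ℤ, k ((b + 1) * M) = k (b * M + (M - 1 : ℕ)) + 1 := by
    intro b
    rw [L.start]
    congr 2
    push_cast [Nat.cast_sub hM]
    ring
  have hmono : ∀ b : ℤ, k (b * M) ≤ k (b * M + (M - 1 : ℕ)) := fun b =>
    L.monotone hM (by omega)
  have hup : ∀ n : ℕ, k (0 * M) + n ≤ k ((n : ℤ) * M) := by
    intro n
    induction n with
    | zero => simp
    | succ n ih =>
      have h1 := hstep n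
      have h2 := hmono n
      push_cast
      omega
  have hdown : ∀ n : ℕ, k (-(n : ℤ) * M) ≤ k (0 * M) - n := by
    intro n
    induction n with
    | zero => simp
    | succ n ih =>
      have h1 := hstep (-((n : ℤ) + 1))
      have h2 := hmono (-((n : ℤ) + 1))
      rw [neg_add, neg_add_cancel_right] at h1
      push_cast
      rw [neg_add] at h2 ⊢
      omega
  have hkm : Monotone k := L.monotone hM
  -- The last block starting at or before `κ` contains it, because the next block starts in the cell
  -- right after this block's last one.
  obtain ⟨b, hb1, hb2⟩ := Int.exists_greatest_of_bdd (P := fun b : ℤ => k (b * M) ≤ κ)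
    ⟨(κ - k (0 * M)).toNat + 1, fun z hz => by
      by_contra! hlt
      have h1 := hup ((κ - k (0 * M)).toNat + 1)
      have h2 : k (((κ - k (0 * M)).toNat + 1 : ℕ) * (M : ℤ)) ≤ k (z * M) :=
        hkm (mul_le_mul_of_nonneg_right (by push_cast; omega) (by positivity))
      push_cast at h1 h2
      omega⟩
    ⟨-((k (0 * M) - κ).toNat : ℤ), by have := hdown (k (0 * M) - κ).toNat; omega⟩
  refine ⟨b, hb1, ?_⟩
  have := mt (hb2 (b + 1)) (by omega)
  rw [hstep] at this
  omega

/-- This bounds the distance between a cell and the sample of its block that controls it. -/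
theorem block_length_le (L : IsLayout m M μ k) (hm : 1 ≤ m) (hμ : ∀ j, μ j ≤ m - 1) (b : ℤ)
    {r : ℕ} (hr : r < M) : k (b * M + r) ≤ k (b * M) + r * m := by
  induction r with
  | zero => simp
  | succ r ih =>
    have ih := ih (by omega)
    have e : b * (M : ℤ) + ((r + 1 : ℕ) : ℤ) - 1 = b * M + r := by push_cast; ring
    rcases Nat.lt_or_ge (r + 1) m with h | h
    · rw [L.cluster b (r + 1) (by omega) h, e]
      push_cast
      nlinarith
    · rw [L.step b (r + 1) h hr, e]
      have h1 : (μ (b * (M : ℤ) + ((r + 1 : ℕ) : ℤ)) : ℤ) + 1 ≤ m := by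
        have := hμ (b * (M : ℤ) + ((r + 1 : ℕ) : ℤ))
        omega
      push_cast at *
      nlinarith

/-- In a block, the number of samples exceeds the number of cells by at most `m ^ 2`. -/
theorem block_weight_le (L : IsLayout m M μ k) (hm : 1 ≤ m) (hM : m ≤ M) (hμ : ∀ j, μ j ≤ m - 1)
    (b : ℤ) : (∑ r ∈ Finset.range M, (1 + μ (b * M + (r : ℕ)) : ℤ)) ≤
      m ^ 2 + (k ((b + 1) * M) - k (b * M)) ∧ (M - m : ℤ) ≤ k ((b + 1) * M) - k (b * M) := by
  -- Only the cluster produces excess: its `m` samples weigh at most `m` each. Afterwards weight and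
  -- cell index grow by the same `1 + μ`, which is at least one.
  have key : ∀ t : ℕ, m - 1 ≤ t → t < M →
      (∑ r ∈ Finset.range (t + 1), (1 + μ (b * M + (r : ℕ)) : ℤ)) ≤
        m ^ 2 + (k (b * M + t) - k (b * M)) ∧ (t + 1 - m : ℤ) ≤ k (b * M + t) - k (b * M) := by
    intro t ht
    induction t, ht using Nat.le_induction with
    | base =>
      intro _
      rw [L.eq_start b (by omega), sub_self, add_zero, Nat.sub_add_cancel hm]
      refine ⟨?_, by omega⟩
      refine (Finset.sum_le_card_nsmul _ _ (m : ℤ) fun r _ => ?_).trans ?_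
      · have := hμ (b * M + (r : ℕ)); omega
      · rw [Finset.card_range, nsmul_eq_mul, sq]
    | succ t ht ih =>
      intro htM
      obtain ⟨h1, h2⟩ := ih (by omega)
      have hstep := L.step b (t + 1) (by omega) htM
      rw [show b * (M : ℤ) + ((t + 1 : ℕ) : ℤ) - 1 = b * M + t by push_cast; ring] at hstep
      rw [Finset.sum_range_succ]
      refine ⟨by omega, by push_cast at *; omega⟩
  obtain ⟨h1, h2⟩ := key (M - 1) (by omega) (by omega)
  have hs := L.start (b + 1)
  rw [show (b + 1) * (M : ℤ) - 1 = b * M + (M - 1 : ℕ) by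
    push_cast [Nat.cast_sub (hm.trans hM)]; ring] at hs
  rw [Nat.sub_add_cancel (hm.trans hM)] at h1
  push_cast [Nat.cast_sub (hm.trans hM)] at *
  exact ⟨by omega, by omega⟩

theorem weight_le (L : IsLayout m M μ k) (hm : 1 ≤ m) (hM : m ≤ M) (hμ : ∀ j, μ j ≤ m - 1)
    (n : ℕ) : (∑ j ∈ Finset.Ico (0 : ℤ) (n * M), (1 + μ j : ℤ)) ≤
      n * m ^ 2 + (k (n * M) - k 0) ∧ (n * (M - m) : ℤ) ≤ k (n * M) - k 0 := by
  induction n with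
  | zero => simp
  | succ n ih =>
    obtain ⟨h1, h2⟩ := L.block_weight_le hm hM hμ n
    have hsplit : (∑ j ∈ Finset.Ico (0 : ℤ) ((n + 1 : ℕ) * M), (1 + μ j : ℤ)) =
        (∑ j ∈ Finset.Ico (0 : ℤ) (n * M), (1 + μ j : ℤ)) +
          ∑ r ∈ Finset.range M, (1 + μ (n * M + (r : ℕ)) : ℤ) := by
      have hn : (0 : ℤ) ≤ (n : ℤ) * M := by positivity
      have e : ((n + 1 : ℕ) : ℤ) * M = n * M + M := by push_cast; ring
      rw [← Finset.Ico_union_Ico_eq_Ico hn (show (n : ℤ) * M ≤ ((n + 1 : ℕ) : ℤ) * M by omega),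
        Finset.sum_union (Finset.Ico_disjoint_Ico_consecutive _ _ _)]
      congr 1
      refine (Finset.sum_bij (fun (r : ℕ) _ => (n : ℤ) * M + r) ?_ ?_ ?_ ?_).symm
      · intro r hr
        have := Finset.mem_range.1 hr
        rw [Finset.mem_Ico]
        omega
      · intro r _ r' _ h
        omega
      · intro j hj
        have := Finset.mem_Ico.1 hj
        exact ⟨(j - n * M).toNat, Finset.mem_range.2 (by omega), by omega⟩
      · intro r _
        rfl
    rw [hsplit]
    push_cast
    refine ⟨by linarith, by linarith⟩

end IsLayout

end ShiftInvariant

/-! ### Density and construction of the sampling set -/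

namespace ShiftInvariant

variable {m M : ℕ} {μ : ℤ → ℕ} {k : ℤ → ℤ}

/-- An upper bound for a liminf of infima needs only one good window for arbitrarily large `R`: the
cells of `n` whole blocks, of total length `ℓ ≥ n (M - m)` and weight at most `ℓ + n m²`. -/
theorem IsLayout.lowerDensity_le (L : IsLayout m M μ k) (hm : 1 ≤ m) (hM : m < M)
    (hμ : ∀ j, μ j ≤ m - 1) {x : ℤ → ℝ} (hx : Function.Injective x)
    (hxk : ∀ j, (k j : ℝ) < x j ∧ x j < k j + 1) {μX : Set.range x → ℕ}
    (hμX : ∀ j, μX ⟨x j, Set.mem_range_self j⟩ = μ j) :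
    lowerDensity (Set.range x) μX ≤ ENNReal.ofReal (1 + (m : ℝ) ^ 2 / (M - m)) := by
  have hMm : (0 : ℝ) < (M : ℝ) - m := by
    have : (m : ℝ) < M := by exact_mod_cast hM
    linarith
  have hkm : Monotone k := L.monotone (by omega)
  refine Filter.liminf_le_of_frequently_le (Filter.frequently_atTop.2 fun a => ?_)
  obtain ⟨n, hn⟩ := exists_nat_ge (max 1 (2 * a))
  have hn1 : (1 : ℝ) ≤ n := (le_max_left _ _).trans hn
  have hn2 : 2 * a ≤ n := (le_max_right _ _).trans hn
  obtain ⟨h1, h2⟩ := L.weight_le hm hM.le hμ n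
  set ℓ : ℝ := (k (n * M) : ℝ) - k 0 with hℓ
  have h1' : (∑ j ∈ Finset.Ico (0 : ℤ) (n * M), (1 + μ j : ℝ)) ≤ n * m ^ 2 + ℓ := by
    rw [hℓ]
    exact_mod_cast h1
  have h2' : n * ((M : ℝ) - m) ≤ ℓ := by
    rw [hℓ]
    exact_mod_cast h2
  have hM1 : (1 : ℝ) ≤ (M : ℝ) - m := by
    have : (m : ℝ) + 1 ≤ M := by exact_mod_cast hM
    linarith
  have hnℓ : (n : ℝ) ≤ ℓ := (le_mul_of_one_le_right (by positivity) hM1).trans h2'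
  have hℓ0 : 0 < ℓ := by linarith
  refine ⟨ℓ / 2, by linarith, (iInf_le _ ((k 0 : ℝ) + ℓ / 2)).trans ?_⟩
  have hsum : (∑' y : {y : Set.range x //
      (y : ℝ) ∈ Set.Icc ((k 0 : ℝ) + ℓ / 2 - ℓ / 2) ((k 0 : ℝ) + ℓ / 2 + ℓ / 2)},
      (1 + (μX y : ℝ≥0∞))) ≤
      ENNReal.ofReal (∑ j ∈ Finset.Ico (0 : ℤ) (n * M), (1 + μ j : ℝ)) := by
    have hx_symm : ∀ y : Set.range x, x ((Equiv.ofInjective x hx).symm y) = y := fun y =>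
      Equiv.apply_ofInjective_symm hx y
    let g : {y : Set.range x //
        (y : ℝ) ∈ Set.Icc ((k 0 : ℝ) + ℓ / 2 - ℓ / 2) ((k 0 : ℝ) + ℓ / 2 + ℓ / 2)} →
        (Finset.Ico (0 : ℤ) (n * M)) := fun y => ⟨(Equiv.ofInjective x hx).symm y.1, by
      have hy := y.2
      rw [← hx_symm y.1] at hy
      set j := (Equiv.ofInjective x hx).symm y.1
      have hj := hxk j
      rw [Finset.mem_Ico]
      constructor
      -- Samples before index `0` lie in earlier cells, and samples from `n * M` on lie strictly to
      -- the right of the closed window because offsets are positive.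
      · by_contra! hlt
        have e1 : k j ≤ k (-1) := hkm (by omega)
        have e2 : k 0 = k (-1) + 1 := by simpa using L.start 0
        have e3 : (k j : ℝ) + 1 ≤ k 0 := by rw [e2]; exact_mod_cast (by omega : k j + 1 ≤ k (-1) + 1)
        linarith [hy.1]
      · by_contra! hle
        have e1 : (k (n * M) : ℝ) ≤ k j := by exact_mod_cast hkm hle
        linarith [hy.2]⟩
    have hg : Function.Injective g := fun y y' h => by
      have := congrArg Subtype.val h
      exact Subtype.ext ((Equiv.ofInjective x hx).symm.injective this)
    calc _ = ∑' y, (1 + (μ (g y) : ℝ≥0∞)) := by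
          refine tsum_congr fun y => ?_
          rw [← hμX (g y)]
          congr 3
          exact Subtype.ext (hx_symm y.1).symm
      _ ≤ ∑' j : Finset.Ico (0 : ℤ) (n * M), (1 + (μ j : ℝ≥0∞)) :=
          ENNReal.tsum_comp_le_tsum_of_injective hg fun j => 1 + (μ j : ℝ≥0∞)
      _ = ∑ j ∈ Finset.Ico (0 : ℤ) (n * M), (1 + (μ j : ℝ≥0∞)) :=
          Finset.tsum_subtype _ fun j => 1 + (μ j : ℝ≥0∞)
      _ = _ := by
          rw [ENNReal.ofReal_sum_of_nonneg fun j _ => by positivity]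
          refine Finset.sum_congr rfl fun j _ => ?_
          rw [ENNReal.ofReal_add zero_le_one (by positivity), ENNReal.ofReal_one,
            ENNReal.ofReal_natCast]
  refine (ENNReal.div_le_div_right hsum _).trans ?_
  rw [mul_div_cancel₀ _ two_ne_zero, ← ENNReal.ofReal_div_of_pos hℓ0]
  refine ENNReal.ofReal_le_ofReal ?_
  rw [div_le_iff₀ hℓ0]
  refine h1'.trans ?_
  rw [add_mul, one_mul, add_comm]
  refine add_le_add le_rfl ?_
  rw [div_mul_eq_mul_div, le_div_iff₀ hMm]
  nlinarith [sq_nonneg (m : ℝ)]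

/-- Finitely many rationals lie in a common lattice. -/
theorem exists_common_lattice (Θ : Finset ℚ) :
    ∃ α : ℝ, 0 < α ∧ ∀ θ ∈ Θ, ∀ k : ℤ, ∃ l : ℤ, (k : ℝ) + θ = α * l := by
  have hN : (0 : ℝ) < ((∏ θ ∈ Θ, θ.den : ℕ) : ℝ) := by
    exact_mod_cast Finset.prod_pos fun (θ : ℚ) _ => θ.den_pos
  refine ⟨((∏ θ ∈ Θ, θ.den : ℕ) : ℝ)⁻¹, inv_pos.2 hN, fun θ hθ k => ?_⟩
  obtain ⟨q, hq⟩ := Finset.dvd_prod_of_mem (fun θ : ℚ => θ.den) hθ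
  refine ⟨k * (∏ θ ∈ Θ, θ.den : ℕ) + θ.num * q, ?_⟩
  rw [eq_inv_mul_iff_mul_eq₀ hN.ne']
  have h1 : ((θ : ℚ) : ℝ) * θ.den = θ.num := by exact_mod_cast Rat.mul_den_eq_num θ
  rw [Int.cast_add, Int.cast_mul, Int.cast_mul, Int.cast_natCast, Int.cast_natCast, mul_add, hq]
  push_cast
  linear_combination (q : ℝ) * h1

variable {φ : ℝ → ℂ}

theorem IsLocalGenerator.exists_sampling_set (hG : IsLocalGenerator m φ) (hm : 1 ≤ m) {ν : ℝ}
    (hν : 0 < ν) (hμ : ∀ j, μ j ≤ m - 1) :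
    ∃ (x : ℤ → ℝ) (μX : Set.range x → ℕ),
      StrictMono x ∧
      (∃ α : ℝ, 0 < α ∧ ∀ j, ∃ k : ℤ, x j = α * k) ∧
      (∀ j, μX ⟨x j, Set.mem_range_self j⟩ = μ j) ∧
      (∀ p : ℝ≥0∞, 1 ≤ p → IsSampling p φ (Set.range x) μX) ∧
      lowerDensity (Set.range x) μX < ENNReal.ofReal (1 + ν) := by
  obtain ⟨y, hymono, hy01, K₁, hK₁, hyK⟩ := hG.exists_nodes
  have hz' : ∀ d : ℕ, ∃ (z : ℚ) (K : ℝ), d ≤ m → 0 < z ∧ z < 1 ∧ 0 ≤ K ∧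
      ∀ (a : ℕ → ℂ) (ε : ℝ), 0 ≤ ε →
        (∀ s < d, ‖∑ i ∈ Finset.range d, a i * shiftDeriv φ s i z‖ ≤ ε) →
        ∀ i < d, ‖a i‖ ≤ K * ε := by
    intro d
    by_cases hd : d ≤ m
    · obtain ⟨z, h1, h2, K, h3, h4⟩ := hG.exists_hermite_node hd
      exact ⟨z, K, fun _ => ⟨h1, h2, h3, h4⟩⟩
    · exact ⟨0, 0, fun h => absurd h hd⟩
  choose z Kz hz using hz'
  have hd : ∀ j, μ j + 1 ≤ m := fun j => by have := hμ j; omega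
  -- This is the condition `m² / (M - m) < ν` solved for `M`.
  obtain ⟨M, hM⟩ := exists_nat_gt (m + (m : ℝ) ^ 2 / ν)
  have hmM' : (m : ℝ) < M := lt_of_le_of_lt (le_add_of_nonneg_right (by positivity)) hM
  have hmM : m < M := by exact_mod_cast hmM'
  have hM0 : 0 < M := by omega
  have hdens : (m : ℝ) ^ 2 / (M - m) < ν := by
    rw [div_lt_iff₀ (by linarith), ← div_lt_iff₀' hν]
    linarith
  obtain ⟨k, L⟩ := exists_isLayout hm hmM.le μ
  -- The offset depends only on the position within the cluster or on the multiplicity, so finitely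
  -- many offsets serve all samples and the constants are uniform.
  let θ : ℤ → ℚ := fun j => if j % (M : ℤ) < m then y (j % (M : ℤ)).toNat else z (μ j + 1)
  have hθ1 : ∀ (b : ℤ) (r : ℕ), r < m → θ (b * M + r) = y r := by
    intro b r hr
    simp only [θ]
    rw [emod_block (by omega), if_pos (by omega), Int.toNat_natCast]
  have hθ2 : ∀ (b : ℤ) (r : ℕ), m ≤ r → r < M → θ (b * M + r) = z (μ (b * M + r) + 1) := by
    intro b r h1 h2
    simp only [θ]
    rw [emod_block h2, if_neg (by omega)]
  let Θ : Finset ℚ := (Finset.range m).image y ∪ (Finset.range (m + 1)).image z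
  have hθΘ : ∀ j, θ j ∈ Θ := by
    intro j
    obtain ⟨b, r, hr, rfl⟩ := exists_block hM0 j
    rcases Nat.lt_or_ge r m with h | h
    · rw [hθ1 b r h]
      exact Finset.mem_union_left _ (Finset.mem_image_of_mem _ (Finset.mem_range.2 h))
    · rw [hθ2 b r h hr]
      exact Finset.mem_union_right _ (Finset.mem_image_of_mem _
        (Finset.mem_range.2 (by have := hd (b * M + r); omega)))
  have hθ01q : ∀ j, 0 < θ j ∧ θ j < 1 := by
    intro j
    obtain ⟨b, r, hr, rfl⟩ := exists_block hM0 j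
    rcases Nat.lt_or_ge r m with h | h
    · rw [hθ1 b r h]; exact hy01 r h
    · rw [hθ2 b r h hr]
      have := hz _ (hd (b * M + r))
      exact ⟨this.1, this.2.1⟩
  have hθ01 : ∀ j, (θ j : ℝ) ∈ Set.Ioo (0 : ℝ) 1 := fun j =>
    ⟨by exact_mod_cast (hθ01q j).1, by exact_mod_cast (hθ01q j).2⟩
  let x : ℤ → ℝ := fun j => k j + θ j
  have hxk : ∀ j, (k j : ℝ) < x j ∧ x j < k j + 1 := fun j =>
    ⟨lt_add_of_pos_right _ (hθ01 j).1, add_lt_add_right (hθ01 j).2 _⟩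
  have hxmono : StrictMono x := by
    refine strictMono_int_of_lt_succ fun j => ?_
    have hlt : k j + 1 ≤ k (j + 1) → x j < x (j + 1) := fun h =>
      ((hxk j).2.trans_le (by exact_mod_cast h)).trans (hxk (j + 1)).1
    obtain ⟨b, r, hr, h⟩ := exists_block hM0 (j + 1)
    have hj : j = b * M + r - 1 := by omega
    rcases Nat.eq_zero_or_pos r with h0 | h0
    · subst h0
      have h1 := L.start b
      rw [Nat.cast_zero, add_zero] at h hj
      exact hlt (by rw [h, h1, hj])
    · rcases Nat.lt_or_ge r m with h1 | h1
      · have h2 := L.cluster b r h0 h1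
        have h3 : j = b * M + ((r - 1 : ℕ) : ℤ) := by omega
        have h4 : θ j = y (r - 1) := by rw [h3, hθ1 b (r - 1) (by omega)]
        have h5 : θ (j + 1) = y r := by rw [h, hθ1 b r h1]
        have h6 : y (r - 1) < y r := by
          have := hymono (r - 1) (by omega)
          rwa [Nat.sub_add_cancel h0] at this
        simp only [x]
        rw [h4, h5, h, h2, hj]
        exact add_lt_add_right (by exact_mod_cast h6) _
      · have h2 := L.step b r h1 hr
        exact hlt (by rw [h, h2, hj]; omega)
  have hxinj := hxmono.injective
  let B : ℕ → ℕ → ℤ → ℂ := fun s i j => shiftDeriv φ s i (θ j)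
  let D : ℝ := ∑ s ∈ Finset.range m, ∑ i ∈ Finset.range m, ∑ q ∈ Θ, ‖shiftDeriv φ s i q‖
  have hD0 : 0 ≤ D := by positivity
  have hD : ∀ j, ∀ s < m, ∀ i < m, ‖B s i j‖ ≤ D := by
    intro j s hs i hi
    calc ‖B s i j‖ ≤ ∑ q ∈ Θ, ‖shiftDeriv φ s i q‖ :=
          Finset.single_le_sum (f := fun q : ℚ => ‖shiftDeriv φ s i q‖)
            (fun _ _ => norm_nonneg _) (hθΘ j)
      _ ≤ ∑ i ∈ Finset.range m, ∑ q ∈ Θ, ‖shiftDeriv φ s i q‖ :=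
          Finset.single_le_sum (f := fun i => ∑ q ∈ Θ, ‖shiftDeriv φ s i q‖)
            (fun _ _ => by positivity) (Finset.mem_range.2 hi)
      _ ≤ D := Finset.single_le_sum
            (f := fun s => ∑ i ∈ Finset.range m, ∑ q ∈ Θ, ‖shiftDeriv φ s i q‖)
            (fun _ _ => by positivity) (Finset.mem_range.2 hs)
  have hKz : ∀ d ∈ Finset.range (m + 1), 0 ≤ Kz d := fun d hd =>
    (hz d (by have := Finset.mem_range.1 hd; omega)).2.2.1
  let K₂ : ℝ := ∑ d ∈ Finset.range (m + 1), Kz d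
  obtain ⟨C, hC0, hC⟩ := L.exists_block_bound hm hmM.le hμ B hK₁ (Finset.sum_nonneg hKz) hD0 hD
    (fun b a ε hε h => hyK a ε hε fun t ht => by
      have := h t ht
      simp only [B] at this
      rwa [hθ1 b t ht] at this)
    (fun b r h1 h2 a ε hε h i hi => by
      have hdj := hd (b * M + r)
      refine ((hz _ hdj).2.2.2 a ε hε (fun s hs => ?_) i hi).trans ?_
      · have := h s hs
        simp only [B] at this
        rwa [hθ2 b r h1 h2] at this
      · exact mul_le_mul_of_nonneg_right (Finset.single_le_sum hKz
          (Finset.mem_range.2 (by omega))) hε) (M - 1) (by omega) (by omega)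
  have hrd : ∀ (c : ℤ → ℂ) (f : ℝ → ℂ),
      (∀ x : ℝ, HasSum (fun l : ℤ => c l * φ (x - l)) (f x)) → ∀ j, ∀ s ≤ μ j,
      rderiv s f (x j) = ∑ i ∈ Finset.range m, c (k j - i) * B s i j := fun c f hf j s hs =>
    hG.rderiv_eq hf (k j) (hθ01 j) (hs.trans (hμ j))
  let μX : Set.range x → ℕ := fun y => μ ((Equiv.ofInjective x hxinj).symm y)
  have hμX : ∀ j, μX ⟨x j, Set.mem_range_self j⟩ = μ j := fun j => by
    simp only [μX]
    rw [Equiv.ofInjective_symm_apply]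
  refine ⟨x, μX, hxmono, ?_, hμX, fun p hp => ?_, ?_⟩
  · obtain ⟨α, hα, h⟩ := exists_common_lattice Θ
    exact ⟨α, hα, fun j => h (θ j) (hθΘ j) (k j)⟩
  · refine hG.isSampling hxinj hμ hμX k (M * m) Θ.card ?_ C.toNNReal (m * D).toNNReal ?_ ?_ hp
    · intro κ
      rw [← Set.encard_coe_eq_coe_finsetCard]
      refine Set.encard_le_encard_of_injOn (f := θ) (fun j _ => hθΘ j) fun i hi j hj h => ?_
      refine hxinj ?_
      simp only [x]
      rw [show k i = κ from hi, show k j = κ from hj, h]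
    · intro c f hf κ
      rw [Real.coe_toNNReal C hC0]
      obtain ⟨b, hb1, hb2⟩ := L.exists_block_of_cell hM0 κ
      -- The largest datum of the block serves as `ε` in the block bound, so this single datum
      -- controls every active coefficient of the cell.
      obtain ⟨⟨r, s⟩, hrs, hmax⟩ := Finset.exists_max_image
        ((Finset.range M).sigma fun r => Finset.range (μ (b * M + (r : ℕ)) + 1))
        (fun q => ‖rderiv q.2 f (x (b * M + (q.1 : ℕ)))‖)
        ⟨⟨0, 0⟩, by simp [hM0]⟩
      rw [Finset.mem_sigma, Finset.mem_range, Finset.mem_range] at hrs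
      simp only at hrs hmax
      refine ⟨b * M + r, s, by omega, ?_, fun i hi => ?_⟩
      · have h1 := L.block_length_le hm hμ b (r := M - 1) (by omega)
        have h2 : k (b * M) ≤ k (b * M + r) := L.monotone hM0 (by omega)
        have h3 : k (b * M + r) ≤ k (b * M + (M - 1 : ℕ)) := L.monotone hM0 (by omega)
        have h4 : (((M - 1 : ℕ) : ℤ) * m) ≤ ((M * m : ℕ) : ℤ) := by
          exact_mod_cast Nat.mul_le_mul_right m (Nat.sub_le M 1)
        rw [abs_le]
        constructor <;> omega
      · refine hC c b _ (norm_nonneg _) (fun r' hr' s' hs' => ?_) (κ - i) (by omega) (by omega)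
        rw [← hrd c f hf _ s' hs']
        exact hmax ⟨r', s'⟩ (Finset.mem_sigma.2 ⟨Finset.mem_range.2 hr',
          Finset.mem_range.2 (by simp only; omega)⟩)
    · intro c f hf j s hs
      rw [Real.coe_toNNReal _ (by positivity)]
      obtain ⟨i, hi, hmax⟩ := Finset.exists_max_image (Finset.range m) (fun i => ‖c (k j - i)‖)
        ⟨0, Finset.mem_range.2 hm⟩
      refine ⟨i, Finset.mem_range.1 hi, ?_⟩
      rw [hrd c f hf j s hs]
      refine (norm_sum_le_of_le _ (n := fun _ => ‖c (k j - i)‖ * D) fun i' hi' => ?_).trans ?_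
      · rw [norm_mul]
        exact mul_le_mul (hmax i' hi') (hD j s (by have := hd j; omega) i' (Finset.mem_range.1 hi'))
          (norm_nonneg _) (norm_nonneg _)
      · rw [Finset.sum_const, Finset.card_range, nsmul_eq_mul]
        exact le_of_eq (by ring)
  · refine (L.lowerDensity_le hm hmM hμ hxinj hxk hμX).trans_lt ?_
    rw [ENNReal.ofReal_lt_ofReal_iff (by linarith)]
    linarith

end ShiftInvariant

theorem theorem4p5 (m : ℕ) (hm : 1 ≤ m) (φ : ℝ → ℂ) (hφ : ShiftInvariant.IsPEBSpline m φ)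
    (ν : ℝ) (hν : 0 < ν) (μ : ℤ → ℕ) (hμ : ∀ j, μ j ≤ m - 1) :
    ∃ (x : ℤ → ℝ) (μX : Set.range x → ℕ),
      StrictMono x ∧
      (∃ α : ℝ, 0 < α ∧ ∀ j, ∃ k : ℤ, x j = α * k) ∧
      (∀ j, μX ⟨x j, Set.mem_range_self j⟩ = μ j) ∧
      (∀ p : ENNReal, 1 ≤ p → ShiftInvariant.IsSampling p φ (Set.range x) μX) ∧
      ShiftInvariant.lowerDensity (Set.range x) μX < ENNReal.ofReal (1 + ν) :=
  (hφ.isLocalGenerator hm).exists_sampling_set hm hν hμ
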